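/- **Setting.** Let $(M^{2n+s},g)$ be a smooth Riemannian manifold with Levi-Civita connection $\nabla$, equipped with a framed $\varphi$-structure: a $(1,1)$-tensor field $\varphi$, vector fields $\xi_1,\dots,\xi_s$ and 1-forms $\eta^1,\dots,\eta^s$ (all smooth) such that $\varphi^2X=-X+\sum_{\alpha}\eta^\alpha(X)\xi_\alpha$, $\eta^\alpha(\xi_\beta)=\delta^\alpha_\beta$, $\varphi\xi_\alpha=0$, $\eta^\alpha(\varphi X)=0$, $\eta^\alpha(X)=g(X,\xi_\alpha)$ and $g(\varphi X,\varphi Y)=g(X,Y)-\sum_\alpha\eta^\alpha(X)\eta^\alpha(Y)$. Put $\Omega(X,Y)=g(X,\varphi Y)$. Assume that $M$ is a $C$-manifold, i.e. that the structure is normal, $N_\varphi(X,Y)=-2\sum_\alpha d\eta^\alpha(X,Y)\,\xi_\alpha$ with $N_\varphi$ the Nijenhuis tensor of $\varphi$, and that $d\Omega=0$ and $d\eta^\alpha=0$ for all $\alpha$. Let $q\neq 0$ and let $\gamma:I\to M$ be a smooth unit-speed curve on an open interval $I$, with $T=\gamma'$. It is a *normal magnetic curve* for the contact magnetic field $F_q=q\,\Omega$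 if $\nabla_TT=\Phi T$, where $g(\Phi X,Y)=F_q(X,Y)$ (so $\Phi=-q\varphi$). It is a *geodesic* if $\nabla_TT=0$. It is *$\theta_\alpha$-slant* if $\eta^\alpha(T)=\cos\theta_\alpha$ with constants $\theta_1,\dots,\theta_s$, and *Legendre* if $\eta^\alpha(T)=0$ for all $\alpha$. A *Frenet curve of osculating order $r$* has orthonormal smooth fields $v_1=T,v_2,\dots,v_r$ along $\gamma$ and positive functions $\kappa_1,\dots,\kappa_{r-1}$ with $\nabla_Tv_i=-\kappa_{i-1}v_{i-1}+\kappa_iv_{i+1}$ for $1\le i\le r$ (terms with $\kappa_0$, $\kappa_r$ omitted). A *circle* is a Frenet curve of order $2$ with $\kappa_1$ constant; a *helix* is a Frenet curve of order $3$ with $\kappa_1,\kappa_2$ constant. **Theorem.** $\gamma$ is a normal magnetic curve for $F_q$ if and only if one of the following holds: (i) $\gamma$ is a geodesic $\theta_\alpha$-slant curve which is an integral curve of $\sum_\alpha\cos\theta_\alpha\,\xi_\alpha$ or of $-\sum_\alpha\cos\theta_\alpha\,\xi_\alpha$, for some $\theta_\alpha$ with $\sum_\alpha\cos^2\theta_\alpha=1$;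 (ii) $\gamma$ is a Legendre circle with $\kappa_1=|q|$ and Frenet frame field $\{T,-\operatorname{sgn}(q)\varphi T\}$; (iii) $\gamma$ is a non-Legendre $\theta_\alpha$-slant helix, for some $\theta_\alpha$ with $\sum_\alpha\cos^2\theta_\alpha<1$, having $$\kappa_1=|q|\sqrt{1-\sum_{\alpha}\cos^2\theta_\alpha},\qquad \kappa_2=|q|\sqrt{\sum_{\alpha}\cos^2\theta_\alpha}$$ and Frenet frame field $\{T,v_2,v_3\}$ with $$v_2=\frac{-\operatorname{sgn}(q)}{\sqrt{1-\sum_{\alpha}\cos^2\theta_\alpha}}\,\varphi T,\qquad v_3=\frac{1}{\sqrt{\sum_{\alpha}\cos^2\theta_\alpha}\sqrt{1-\sum_{\alpha}\cos^2\theta_\alpha}}\Bigl(\sum_{\alpha}\cos\theta_\alpha\,\xi_\alpha-\Bigl(\sum_{\alpha}\cos^2\theta_\alpha\Bigr)T\Bigr).$$ -/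

import Mathlib

open Bundle FiberBundle VectorField
open scoped Manifold ContDiff

noncomputable section

namespace MagneticCurves

section LeviCivita

variable {E : Type*} [NormedAddCommGroup E] [NormedSpace ℝ E] [FiniteDimensional ℝ E]
  {H : Type*} [TopologicalSpace H] {I : ModelWithCorners ℝ E H}
  {M : Type*} [TopologicalSpace M] [ChartedSpace H M] [IsManifold I ∞ M]
  (g : ContMDiffRiemannianMetric I ∞ E (fun x : M => TangentSpace I x))

/-- `nabla` is a Levi-Civita connection of `g`: torsion-free and compatible with the metric.
Note that `nabla Y x u` is `∇_u Y` at `x`. -/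
def IsLeviCivita (nabla : CovariantDerivative I E (TangentSpace I : M → Type _)) : Prop :=
  (∀ (x : M) (X Y : Π y : M, TangentSpace I y), MDiffAt (T% X) x → MDiffAt (T% Y) x →
      nabla Y x (X x) - nabla X x (Y x) = mlieBracket I X Y x) ∧
  (∀ (x : M) (X Y Z : Π y : M, TangentSpace I y),
      MDiffAt (T% X) x → MDiffAt (T% Y) x → MDiffAt (T% Z) x →
      d% (fun y => g.inner y (Y y) (Z y)) x (X x) =
        g.inner x (nabla Y x (X x)) (Z x) + g.inner x (Y x) (nabla Z x (X x)))

/-- The right-hand side of the Koszul formula, i.e. `2 g(∇_X Y, Z)`. -/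
def koszul (X Y Z : Π x : M, TangentSpace I x) (x : M) : ℝ :=
  d% (fun y => g.inner y (Y y) (Z y)) x (X x)
    + d% (fun y => g.inner y (X y) (Z y)) x (Y x)
    - d% (fun y => g.inner y (X y) (Y y)) x (Z x)
    + g.inner x (mlieBracket I X Y x) (Z x)
    - g.inner x (mlieBracket I X Z x) (Y x)
    - g.inner x (mlieBracket I Y Z x) (X x)

set_option linter.unusedSectionVars false in
theorem mdiff_inner {Y Z : Π x : M, TangentSpace I x} {x : M}
   (hY : MDiffAt (T% Y) x) (hZ : MDiffAt (T% Z) x) :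
   MDiffAt (fun y => g.inner y (Y y) (Z y)) x := by
    have : MDifferentiableAt I (I.prod 𝓘(ℝ))
      (fun m ↦ TotalSpace.mk' ℝ (E := Bundle.Trivial M ℝ) m (g.inner m (Y m) (Z m))) x := by
      apply MDifferentiableAt.clm_bundle_apply₂ (F₁ := E) (F₂ := E)
      · exact (g.contMDiff.mdifferentiableAt (by simp))
      · exact hY
      · exact hZ
    simp only [mdifferentiableAt_totalSpace] at this
    exact this.2

theorem tensorial₁ {Y Z : Π x : M, TangentSpace I x} {x : M}
   (hY : MDiffAt (T% Y) x) (hZ : MDiffAt (T% Z) x) :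
   TensorialAt I E (fun X => koszul g X Y Z x) x where
  smul {f X} hf hX := by
    have : CompleteSpace E := FiniteDimensional.complete ℝ E
    simp [koszul,  mvfderiv_fun_mul hf (mdiff_inner g hX hY),
     mvfderiv_fun_mul hf (mdiff_inner g hX hZ), mlieBracket_smul_left hf hX]
    ring
  add {X X'} hX hX' := by
    have : CompleteSpace E := FiniteDimensional.complete ℝ E
    simp [koszul, mvfderiv_fun_add (mdiff_inner g hX hY) (mdiff_inner g hX' hY),
     mvfderiv_fun_add (mdiff_inner g hX hZ) (mdiff_inner g hX' hZ), mlieBracket_add_left hX hX']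
    ring
theorem tensorial₂ {X Y : Π x : M, TangentSpace I x} {x : M}
   (hX : MDiffAt (T% X) x) (hY : MDiffAt (T% Y) x) :
   TensorialAt I E (fun Z => koszul g X Y Z x) x where
  smul {f Z} hf hZ := by
    have : CompleteSpace E := FiniteDimensional.complete ℝ E
    simp [koszul,  mvfderiv_fun_mul hf (mdiff_inner g hX hZ),
     mvfderiv_fun_mul hf (mdiff_inner g hY hZ), mlieBracket_smul_right hf hZ]
    rw [g.symm x (Z x) (Y x), g.symm x (Z x) (X x)]
    ring
  add {Z Z'} hZ hZ' := by
    have : CompleteSpace E := FiniteDimensional.complete ℝ E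
    simp [koszul, mvfderiv_fun_add (mdiff_inner g hX hZ) (mdiff_inner g hX hZ'),
     mvfderiv_fun_add (mdiff_inner g hY hZ) (mdiff_inner g hY hZ'), mlieBracket_add_right hZ hZ']
    ring

theorem exists_riesz (x : M) (B : TangentSpace I x →L[ℝ] TangentSpace I x →L[ℝ] ℝ) :
    ∃ L : TangentSpace I x →L[ℝ] TangentSpace I x, ∀ u w, g.inner x (L u) w = B u w := by
  have : FiniteDimensional ℝ (TangentSpace I x) := inferInstanceAs (FiniteDimensional ℝ E)
  have : T2Space (TangentSpace I x) := inferInstanceAs (T2Space E)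
  let G : LinearMap.BilinForm ℝ (TangentSpace I x) :=
    LinearMap.mk₂ ℝ (fun u w => g.inner x u w) (by simp) (by simp) (by simp) (by simp)
  have hG : G.Nondegenerate := by
    constructor
    · intro u hu
      by_contra h
      exact (g.pos x u h).ne' (hu u)
    · intro u hu
      by_contra h
      exact (g.pos x u h).ne' (hu u)
  let B' : TangentSpace I x →ₗ[ℝ] Module.Dual ℝ (TangentSpace I x) :=
    LinearMap.mk₂ ℝ (fun u w => B u w) (by simp) (by simp) (by simp) (by simp)
  refine ⟨LinearMap.toContinuousLinearMap ((G.toDual hG).symm.toLinearMap ∘ₗ B'), fun u w => ?_⟩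
  exact LinearMap.BilinForm.apply_toDual_symm_apply (B := G) (hB := hG) (B' u) w

theorem exists_koszul {Y : Π x : M, TangentSpace I x} {x : M} (hY : MDiffAt (T% Y) x) :
    ∃ L : TangentSpace I x →L[ℝ] TangentSpace I x, ∀ X Z : Π x : M, TangentSpace I x,
      MDiffAt (T% X) x → MDiffAt (T% Z) x → 2 * g.inner x (L (X x)) (Z x) = koszul g X Y Z x := by
  obtain ⟨L, hL⟩ := exists_riesz g x (TensorialAt.mkHom₂ (fun X Z => koszul g X Y Z x) x
    (fun Z hZ => tensorial₁ g hY hZ) (fun X hX => tensorial₂ g hX hY))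
  refine ⟨(1 / 2 : ℝ) • L, fun X Z hX hZ => ?_⟩
  have h := hL (X x) (Z x)
  rw [TensorialAt.mkHom₂_apply _ _ hX hZ] at h
  rw [← h]
  simp

set_option linter.unusedSectionVars false in
theorem ext_inner {x : M} {u v : TangentSpace I x}
    (h : ∀ Z : Π x : M, TangentSpace I x, MDiffAt (T% Z) x →
      g.inner x u (Z x) = g.inner x v (Z x)) : u = v := by
  by_contra hne
  have h0 := h (extend E (u - v)) (mdifferentiableAt_extend ..)
  rw [extend_apply_self] at h0
  have h1 := g.pos x (u - v) (sub_ne_zero.2 hne)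
  rw [map_sub (g.inner x)] at h1
  simp only [_root_.sub_apply] at h1
  linarith

/-- Existence of the Levi-Civita connection. -/
theorem exists_isLeviCivita :
    ∃ nabla : CovariantDerivative I E (TangentSpace I : M → Type _), IsLeviCivita g nabla := by
  classical
  have : CompleteSpace E := FiniteDimensional.complete ℝ E
  let D : (Π x : M, TangentSpace I x) → (Π x : M, TangentSpace I x →L[ℝ] TangentSpace I x) :=
    fun Y x => if hY : MDiffAt (T% Y) x then (exists_koszul g hY).choose else 0
  have hD : ∀ {X Y Z : Π x : M, TangentSpace I x} {x : M}, MDiffAt (T% X) x → MDiffAt (T% Y) x →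
      MDiffAt (T% Z) x → 2 * g.inner x (D Y x (X x)) (Z x) = koszul g X Y Z x := by
    intro X Y Z x hX hY hZ
    simp only [D, dif_pos hY]
    exact (exists_koszul g hY).choose_spec X Z hX hZ
  have hcov : IsCovariantDerivativeOn E D := by
    constructor
    · intro Y Y' x hY hY' _
      ext u
      refine ext_inner g fun Z hZ => ?_
      have hX := mdifferentiableAt_extend I E u
      have h1 := hD hX hY hZ
      have h2 := hD hX hY' hZ
      have h3 := hD hX (mdifferentiableAt_add_section hY hY') hZ
      rw [extend_apply_self] at h1 h2 h3
      have h4 : koszul g (extend E u) (Y + Y') Z x =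
          koszul g (extend E u) Y Z x + koszul g (extend E u) Y' Z x := by
        simp [koszul, mvfderiv_fun_add (mdiff_inner g hY hZ) (mdiff_inner g hY' hZ),
          mvfderiv_fun_add (mdiff_inner g hX hY) (mdiff_inner g hX hY'),
          mlieBracket_add_right hY hY', mlieBracket_add_left hY hY']
        ring
      simp
      change 2 * g.inner x (D (Y + Y') x u) (Z x) = _ at h3
      linarith
    · intro Y f x hY hf _
      ext u
      refine ext_inner g fun Z hZ => ?_
      have hX := mdifferentiableAt_extend I E u
      have h1 := hD hX hY hZ
      have h3 := hD hX (hf.smul_section hY) hZ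
      rw [extend_apply_self] at h1 h3
      have h4 : koszul g (extend E u) (f • Y) Z x =
          f x * koszul g (extend E u) Y Z x + 2 * (d% f x u * g.inner x (Y x) (Z x)) := by
        simp [koszul, mvfderiv_fun_mul hf (mdiff_inner g hY hZ),
          mvfderiv_fun_mul hf (mdiff_inner g hX hY),
          mlieBracket_smul_right hf hY, mlieBracket_smul_left hf hY]
        rw [g.symm x (Y x) u]
        ring
      simp
      change 2 * g.inner x (D (f • Y) x u) (Z x) = _ at h3
      rw [h4, ← h1] at h3
      linarith
  refine ⟨⟨D, hcov⟩, fun x X Y hX hY => ?_, fun x X Y Z hX hY hZ => ?_⟩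
  · refine ext_inner g fun Z hZ => ?_
    have h1 := hD hX hY hZ
    have h2 := hD hY hX hZ
    have h3 : (fun y => g.inner y (X y) (Y y)) = fun y => g.inner y (Y y) (X y) :=
      funext fun y => g.symm y _ _
    simp only [koszul] at h1 h2
    rw [mlieBracket_swap_apply (V := Y)] at h2
    rw [h3] at h1
    simp at h1 h2 ⊢
    linarith
  · have h1 := hD hX hY hZ
    have h2 := hD hX hZ hY
    have h3 : (fun y => g.inner y (Y y) (Z y)) = fun y => g.inner y (Z y) (Y y) :=
      funext fun y => g.symm y _ _
    simp only [koszul] at h1 h2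
    rw [mlieBracket_swap_apply (V := Z) (W := Y)] at h2
    rw [h3] at h1 ⊢
    change _ = g.inner x (D Y x (X x)) (Z x) + g.inner x (Y x) (D Z x (X x))
    rw [g.symm x (Y x)]
    simp at h1 h2 ⊢
    linarith

/-- The Levi-Civita connection of the Riemannian metric `g`. -/
def leviCivita : CovariantDerivative I E (TangentSpace I : M → Type _) :=
  (exists_isLeviCivita g).choose

theorem isLeviCivita_leviCivita : IsLeviCivita g (leviCivita g) :=
  (exists_isLeviCivita g).choose_spec

end LeviCivita

section Curves

variable {E : Type*} [NormedAddCommGroup E] [NormedSpace ℝ E] [FiniteDimensional ℝ E]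
  {H : Type*} [TopologicalSpace H] {I : ModelWithCorners ℝ E H}
  {M : Type*} [TopologicalSpace M] [ChartedSpace H M] [IsManifold I ∞ M]

variable (I) in
/-- The velocity `γ'(t)` of a curve in `M`. -/
def velocity (γ : ℝ → M) (t : ℝ) : TangentSpace I (γ t) :=
  mfderiv 𝓘(ℝ, ℝ) I γ t (1 : ℝ)

variable (g : ContMDiffRiemannianMetric I ∞ E (fun x : M => TangentSpace I x))

/-- The covariant derivative `∇_{γ'} V` at `t₀` of a vector field `V` along the curve `γ`.
In the local coordinate frame `E_j` of the tangent bundle around `γ t₀`, write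
`V t = ∑ V^j(t) E_j(γ t)`. Then `∇_{γ'} V = ∑ (V^j)' E_j + ∑ V^j ∇_{γ'} E_j`. The first term below is
the first sum; `extend E (V t₀)` is the local field with constant components
`∑ V^j(t₀) E_j`, so the second term is the second sum. -/
def covDerivAlong (γ : ℝ → M) (V : Π t : ℝ, TangentSpace I (γ t)) (t₀ : ℝ) :
    TangentSpace I (γ t₀) :=
  (trivializationAt E (TangentSpace I) (γ t₀)).symm (γ t₀)
      (deriv (fun t : ℝ => (trivializationAt E (TangentSpace I : M → Type _) (γ t₀)
        (⟨γ t, V t⟩ : TangentBundle I M)).2) t₀)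
    + leviCivita g (extend E (V t₀)) (γ t₀) (velocity I γ t₀)

/-- A smooth unit-speed curve defined on the open interval `J`. -/
structure IsUnitSpeedCurve (γ : ℝ → M) (J : Set ℝ) : Prop where
  isOpen : IsOpen J
  ordConnected : J.OrdConnected
  nonempty : J.Nonempty
  contMDiffOn : ContMDiffOn 𝓘(ℝ, ℝ) I ∞ γ J
  unit_speed : ∀ t ∈ J, g.inner (γ t) (velocity I γ t) (velocity I γ t) = 1

/-- `γ` is a geodesic: `∇_T T = 0`. -/
def IsGeodesic (γ : ℝ → M) (J : Set ℝ) : Prop :=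
  ∀ t ∈ J, covDerivAlong g γ (velocity I γ) t = 0

/-- The unit-speed curve `γ` is a Frenet curve of osculating order `r` with Frenet frame field
`v 1 = T, v 2, …, v r` and curvatures `κ 1, …, κ (r - 1)`. The other values of `v` and `κ`
are irrelevant. -/
structure IsFrenetCurve (γ : ℝ → M) (J : Set ℝ) (r : ℕ)
    (v : ℕ → Π t : ℝ, TangentSpace I (γ t)) (κ : ℕ → ℝ → ℝ) : Prop where
  isUnitSpeedCurve : IsUnitSpeedCurve g γ J
  one_le : 1 ≤ r
  smooth : ∀ i ∈ Set.Icc 1 r,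
    ContMDiffOn 𝓘(ℝ, ℝ) I.tangent ∞ (fun t => (⟨γ t, v i t⟩ : TangentBundle I M)) J
  orthonormal : ∀ t ∈ J, ∀ i ∈ Set.Icc 1 r, ∀ j ∈ Set.Icc 1 r,
    g.inner (γ t) (v i t) (v j t) = if i = j then 1 else 0
  v_one : ∀ t ∈ J, v 1 t = velocity I γ t
  curvature_pos : ∀ i ∈ Set.Ico 1 r, ∀ t ∈ J, 0 < κ i t
  frenet : ∀ i ∈ Set.Icc 1 r, ∀ t ∈ J, covDerivAlong g γ (v i) t =
    (if 1 < i then -(κ (i - 1) t • v (i - 1) t) else 0)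
      + (if i < r then κ i t • v (i + 1) t else 0)

/-- A circle: a Frenet curve of osculating order `2` with `κ₁` a positive constant. -/
def IsCircle (γ : ℝ → M) (J : Set ℝ)
    (v : ℕ → Π t : ℝ, TangentSpace I (γ t)) (κ : ℕ → ℝ → ℝ) : Prop :=
  IsFrenetCurve g γ J 2 v κ ∧ ∃ c : ℝ, 0 < c ∧ ∀ t ∈ J, κ 1 t = c

/-- A helix: a Frenet curve of osculating order `3` with `κ₁`, `κ₂` positive constants. -/
def IsHelix (γ : ℝ → M) (J : Set ℝ)
    (v : ℕ → Π t : ℝ, TangentSpace I (γ t)) (κ : ℕ → ℝ → ℝ) : Prop :=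
  IsFrenetCurve g γ J 3 v κ ∧ (∃ c : ℝ, 0 < c ∧ ∀ t ∈ J, κ 1 t = c) ∧
    ∃ c : ℝ, 0 < c ∧ ∀ t ∈ J, κ 2 t = c

/-- `Φ` is the Lorentz force of the 2-form `F`: `g(ΦX, Y) = F(X, Y)`. -/
def IsLorentzForce (F : Π x : M, TangentSpace I x → TangentSpace I x → ℝ)
    (Φ : Π x : M, TangentSpace I x →L[ℝ] TangentSpace I x) : Prop :=
  ∀ (x : M) (X Y : TangentSpace I x), g.inner x (Φ x X) Y = F x X Y

/-- `γ` is a magnetic curve for `F`: it satisfies the Lorentz equation `∇_T T = Φ T`, where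
`Φ` is the Lorentz force of `F`. -/
def IsMagneticCurve (F : Π x : M, TangentSpace I x → TangentSpace I x → ℝ)
    (γ : ℝ → M) (J : Set ℝ) : Prop :=
  ∃ Φ : Π x : M, TangentSpace I x →L[ℝ] TangentSpace I x, IsLorentzForce g F Φ ∧
    ∀ t ∈ J, covDerivAlong g γ (velocity I γ) t = Φ (γ t) (velocity I γ t)

/-- A normal magnetic curve: a magnetic curve of unit speed. -/
def IsNormalMagneticCurve (F : Π x : M, TangentSpace I x → TangentSpace I x → ℝ)
    (γ : ℝ → M) (J : Set ℝ) : Prop :=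
  IsUnitSpeedCurve g γ J ∧ IsMagneticCurve g F γ J

end Curves

section CManifold

variable {E : Type*} [NormedAddCommGroup E] [NormedSpace ℝ E]
  {H : Type*} [TopologicalSpace H] {I : ModelWithCorners ℝ E H}
  {M : Type*} [TopologicalSpace M] [ChartedSpace H M] [IsManifold I ∞ M]

/-- The exterior derivative of a 1-form, evaluated on vector fields, with the normalization
`dη(X, Y) = (1/2) (X η(Y) - Y η(X) - η([X, Y]))`. -/
def extDerivOne (η : Π x : M, TangentSpace I x →L[ℝ] ℝ)
    (X Y : Π x : M, TangentSpace I x) (x : M) : ℝ :=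
  (1 / 2) * (d% (fun y => η y (Y y)) x (X x) - d% (fun y => η y (X y)) x (Y x)
    - η x (mlieBracket I X Y x))

/-- The exterior derivative of a 2-form, evaluated on vector fields, in the same
normalization. -/
def extDerivTwo (σ : Π x : M, TangentSpace I x → TangentSpace I x → ℝ)
    (X Y Z : Π x : M, TangentSpace I x) (x : M) : ℝ :=
  (1 / 3) * (d% (fun y => σ y (Y y) (Z y)) x (X x)
    + d% (fun y => σ y (Z y) (X y)) x (Y x)
    + d% (fun y => σ y (X y) (Y y)) x (Z x)
    - σ x (mlieBracket I X Y x) (Z x)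
    - σ x (mlieBracket I Y Z x) (X x)
    - σ x (mlieBracket I Z X x) (Y x))

/-- The Nijenhuis tensor
`N_φ(X, Y) = φ²[X, Y] + [φX, φY] - φ[φX, Y] - φ[X, φY]` of a (1,1)-tensor field. -/
def nijenhuis (φ : Π x : M, TangentSpace I x →L[ℝ] TangentSpace I x)
    (X Y : Π x : M, TangentSpace I x) (x : M) : TangentSpace I x :=
  φ x (φ x (mlieBracket I X Y x))
    + mlieBracket I (fun y => φ y (X y)) (fun y => φ y (Y y)) x
    - φ x (mlieBracket I (fun y => φ y (X y)) Y x)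
    - φ x (mlieBracket I X (fun y => φ y (Y y)) x)

variable (g : ContMDiffRiemannianMetric I ∞ E (fun x : M => TangentSpace I x)) (s : ℕ)

/-- A framed `φ`-structure `(φ, ξ_α, η^α, g)`, `α = 1, …, s`, on the Riemannian manifold
`(M, g)`. -/
structure FramedPhiStructure where
  φ : Π x : M, TangentSpace I x →L[ℝ] TangentSpace I x
  ξ : Fin s → Π x : M, TangentSpace I x
  η : Fin s → Π x : M, TangentSpace I x →L[ℝ] ℝ
  φ_smooth : ContMDiff I (I.prod 𝓘(ℝ, E →L[ℝ] E)) ∞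
    (fun x => TotalSpace.mk' (E →L[ℝ] E)
      (E := fun x : M => TangentSpace I x →L[ℝ] TangentSpace I x) x (φ x))
  ξ_smooth : ∀ α, ContMDiff I I.tangent ∞ (fun x => (⟨x, ξ α x⟩ : TangentBundle I M))
  η_smooth : ∀ α, ContMDiff I (I.prod 𝓘(ℝ, E →L[ℝ] ℝ)) ∞
    (fun x => TotalSpace.mk' (E →L[ℝ] ℝ)
      (E := fun x : M => TangentSpace I x →L[ℝ] Bundle.Trivial M ℝ x) x (η α x))
  φ_sq : ∀ (x : M) (X : TangentSpace I x), φ x (φ x X) = -X + ∑ α, η α x X • ξ α x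
  η_ξ : ∀ (x : M) (α β : Fin s), η α x (ξ β x) = if α = β then 1 else 0
  φ_ξ : ∀ (x : M) (α : Fin s), φ x (ξ α x) = 0
  η_φ : ∀ (x : M) (α : Fin s) (X : TangentSpace I x), η α x (φ x X) = 0
  η_eq : ∀ (x : M) (α : Fin s) (X : TangentSpace I x), η α x X = g.inner x X (ξ α x)
  g_φ_φ : ∀ (x : M) (X Y : TangentSpace I x),
    g.inner x (φ x X) (φ x Y) = g.inner x X Y - ∑ α, η α x X * η α x Y

namespace FramedPhiStructure

variable {g s} (C : FramedPhiStructure g s)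

/-- The fundamental 2-form `Ω(X, Y) = g(X, φY)`. -/
def fundamentalForm (x : M) (X Y : TangentSpace I x) : ℝ :=
  g.inner x X (C.φ x Y)

/-- The framed `φ`-structure is a `C`-structure: it is normal, i.e.
`N_φ(X, Y) = -2 ∑ dη^α(X, Y) ξ_α`, and `dΩ = 0`, `dη^α = 0`. -/
structure IsCManifold : Prop where
  normal : ∀ (x : M) (X Y : Π y : M, TangentSpace I y), MDiffAt (T% X) x → MDiffAt (T% Y) x →
    nijenhuis C.φ X Y x = -((2 : ℝ) • ∑ α, extDerivOne (C.η α) X Y x • C.ξ α x)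
  d_fundamentalForm : ∀ (x : M) (X Y Z : Π y : M, TangentSpace I y), MDiffAt (T% X) x →
    MDiffAt (T% Y) x → MDiffAt (T% Z) x → extDerivTwo C.fundamentalForm X Y Z x = 0
  d_η : ∀ (α : Fin s) (x : M) (X Y : Π y : M, TangentSpace I y), MDiffAt (T% X) x →
    MDiffAt (T% Y) x → extDerivOne (C.η α) X Y x = 0

/-- The contact magnetic field `F_q = q Ω` of strength `q`. -/
def contactMagneticField (q : ℝ) (x : M) (X Y : TangentSpace I x) : ℝ :=
  q * C.fundamentalForm x X Y

/-- `γ` is a `θ_α`-slant curve: `η^α(T) = cos θ_α` with constant contact angles `θ_α`. -/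
def IsSlant (γ : ℝ → M) (J : Set ℝ) (θ : Fin s → ℝ) : Prop :=
  ∀ t ∈ J, ∀ α, C.η α (γ t) (velocity I γ t) = Real.cos (θ α)

/-- `γ` is a Legendre curve: `η^α(T) = 0` for all `α`. -/
def IsLegendre (γ : ℝ → M) (J : Set ℝ) : Prop :=
  ∀ t ∈ J, ∀ α, C.η α (γ t) (velocity I γ t) = 0

/-- The vector field `∑ cos θ_α ξ_α`. -/
def slantField (θ : Fin s → ℝ) (x : M) : TangentSpace I x :=
  ∑ α, Real.cos (θ α) • C.ξ α x

end FramedPhiStructure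

end CManifold

end MagneticCurves

end

open MagneticCurves

/-!
The heart of the matter is that on a `C`-manifold both `φ` and the fields `ξ_α` are parallel.
Write `A(X, Y, Z) = g((∇_X φ) Y, Z)` and `B_α(X, Y) = g(∇_X ξ_α, Y)`. Since `φ` is skew for `g`,
`A` is skew in its last two slots; `dΩ = 0` says that its cyclic sum vanishes; since the
Levi-Civita connection is torsion-free, the vanishing of the Nijenhuis tensor is a linear relation
between values of `A`; `dη^α = 0` says that `B_α` is symmetric; orthonormality of the `ξ_α` gives
`B_α(X, ξ_β) = -B_β(X, ξ_α)`. These pointwise relations alone force `A = 0` and `B_α = 0`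
(`parallel_of_normal_closed`, `FramedPhiStructure.IsCManifold.parallel`).

To use this along a curve, a field `V` along `γ` is expanded near `t₀` as `∑ f_i • X_i ∘ γ` with
vector fields `X_i` on `M` (`MDiffAlongAt.exists_eq_sum`). The covariant derivative along `γ` is
additive, satisfies the Leibniz rule, and equals `∇_{γ'} X` on a restriction `X ∘ γ`
(`covDerivAlong_comp`); so it commutes with the parallel tensor `φ` and is compatible with the
metric (`hasDerivAt_inner_comp`).

The Lorentz force of `q Ω` is `-q φ`, so a normal magnetic curve is a unit-speed curve with `∇_T T
= -q φ T`. Then `η^α(T)' = g(-q φ T, ξ_α) = 0`, hence `η^α(T) = cos θ_α` is constant, and `|φ T|²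
= 1 - K` with `K = ∑ cos² θ_α ≤ 1`. If `K = 1` then `φ T = 0` and `T = ∑ cos θ_α ξ_α`. Otherwise
differentiating `φ T` once more, with `∇_T (φ T) = φ (∇_T T) = q (T - ∑ cos θ_α ξ_α)`, yields the
Frenet equations of a circle if `K = 0` (`FramedPhiStructure.IsCManifold.exists_isCircle`) and of
a helix if `0 < K < 1` (`FramedPhiStructure.IsCManifold.exists_isHelix`). Conversely, in each of
the three cases the first Frenet equation, or `φ ξ_α = 0`, is the Lorentz equation.
-/

namespace MagneticCurves

open scoped Topology

/-! ### Linear algebra at a point -/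

section Algebra

variable {V : Type*} [AddCommGroup V] [Module ℝ V] {s : ℕ}

/-- The pointwise algebra behind the parallelism of a `C`-structure. Here `A X Y Z` stands for
`g((∇_X φ) Y, Z)` and `B α X Y` for `g(∇_X ξ_α, Y)`; `A_cyclic` is `dΩ = 0`, `A_normal` is
`N_φ = 0`, `B_symm` is `dη^α = 0`, and `B_skew` comes from `g(ξ_α, ξ_β)` being constant. -/
theorem parallel_of_normal_closed (φ : V →ₗ[ℝ] V) (ξ : Fin s → V) (η : Fin s → V → ℝ)
    (A : V →ₗ[ℝ] V →ₗ[ℝ] V →ₗ[ℝ] ℝ) (B : Fin s → V →ₗ[ℝ] V →ₗ[ℝ] ℝ)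
    (φ_sq : ∀ X, φ (φ X) = -X + ∑ α, η α X • ξ α) (φ_ξ : ∀ α, φ (ξ α) = 0)
    (A_skew : ∀ X Y Z, A X Y Z = -A X Z Y)
    (A_cyclic : ∀ X Y Z, A X Y Z + A Y Z X + A Z X Y = 0)
    (A_normal : ∀ X Y Z, A (φ X) Y Z - A (φ Y) X Z + A X Y (φ Z) - A Y X (φ Z) = 0)
    (A_ξ : ∀ α X Z, A X (ξ α) Z = B α X (φ Z))
    (B_symm : ∀ α X Y, B α X Y = B α Y X)
    (B_skew : ∀ α β X, B α X (ξ β) = -B β X (ξ α)) :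
    (∀ X Y Z, A X Y Z = 0) ∧ ∀ α X Y, B α X Y = 0 := by
  have hA : ∀ X Y Z, A (φ X) Y Z = 0 := by
    -- Combining normality with the cyclic identity, `P X Y Z = A (φ X) Y Z` equals the sum of its
    -- two cyclic permutations; adding two such relations kills the third permutation.
    have h1 : ∀ X Y Z, A (φ X) Y Z = A (φ Y) Z X + A (φ Z) X Y := by
      intro X Y Z
      linarith [A_normal Y Z X, A_cyclic (φ X) Y Z, A_skew Z Y (φ X), A_skew (φ Z) Y X]
    intro X Y Z
    linarith [h1 Y Z X, h1 Z X Y]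
  have decomp : ∀ X, X = -φ (φ X) + ∑ α, η α X • ξ α := fun X => by rw [φ_sq]; abel
  have φ_cube : ∀ X, φ (φ (φ X)) = -φ X := fun X => by
    rw [φ_sq X]
    simp [φ_ξ]
  have hφφ : ∀ α X Y, B α (φ X) (φ Y) = 0 := fun α X Y => by rw [← A_ξ, hA]
  have hξφ : ∀ α β Y, B α (ξ β) (φ Y) = 0 := fun α β Y => by
    -- `N_φ(ξ_α, ξ_β) = 0` says that `ξ_α` and `ξ_β` commute modulo the span of the `ξ_γ`.
    have h1 := A_normal (ξ α) (ξ β) (φ Y)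
    rw [hA, hA, A_ξ, A_ξ, φ_cube] at h1
    simp only [map_neg] at h1
    linarith [B_symm α (ξ β) (φ Y), B_skew α β (φ Y), B_symm β (φ Y) (ξ α)]
  have hξξ : ∀ α β γ, B α (ξ β) (ξ γ) = 0 := fun α β γ => by
    -- As a function of `α, β, γ` this is symmetric in one pair of slots and skew in another.
    linarith [B_skew α γ (ξ β), B_symm γ (ξ β) (ξ α), B_skew γ β (ξ α), B_symm β (ξ α) (ξ γ),
      B_skew β α (ξ γ), B_symm α (ξ γ) (ξ β)]
  have hξ : ∀ α β Y, B α (ξ β) Y = 0 := fun α β Y => by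
    rw [decomp Y]
    simp [hξφ, hξξ]
  have hB : ∀ α X Y, B α X Y = 0 := fun α X Y => by
    have h1 : B α (φ (φ X)) Y = 0 := by
      rw [B_symm, decomp Y]
      simp [hφφ, hξ]
    rw [decomp X]
    simp [hξ, h1]
  refine ⟨fun X Y Z => ?_, hB⟩
  have hAξ : ∀ α, A (ξ α) Y Z = 0 := fun α => by
    linarith [A_cyclic (ξ α) Y Z, A_skew Y Z (ξ α), A_ξ α Y Z, A_ξ α Z Y, hB α Y (φ Z),
      hB α Z (φ Y)]
  rw [decomp X]
  simp [hA, hAξ]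

theorem sign_mul_self_eq_abs (q : ℝ) : Real.sign q * q = |q| := by
  rcases lt_trichotomy q 0 with h | rfl | h
  · simp [Real.sign_of_neg h, abs_of_neg h]
  · simp
  · simp [Real.sign_of_pos h, abs_of_pos h]

theorem sign_mul_sign {q : ℝ} (hq : q ≠ 0) : Real.sign q * Real.sign q = 1 := by
  rcases Real.sign_apply_eq_of_ne_zero q hq with h | h <;> simp [h]

theorem abs_mul_sign {q : ℝ} (hq : q ≠ 0) : |q| * Real.sign q = q := by
  rw [← sign_mul_self_eq_abs]
  linear_combination q * sign_mul_sign hq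

end Algebra

/-! ### Parallelism of the structure tensors -/

section Parallel

variable {E : Type*} [NormedAddCommGroup E] [NormedSpace ℝ E]
  {H : Type*} [TopologicalSpace H] {I : ModelWithCorners ℝ E H}
  {M : Type*} [TopologicalSpace M] [ChartedSpace H M] [IsManifold I ∞ M]
  {g : ContMDiffRiemannianMetric I ∞ E (fun x : M => TangentSpace I x)} {s : ℕ}

theorem inner_self_nonneg {x : M} (u : TangentSpace I x) : 0 ≤ g.inner x u u := by
  by_cases h : u = 0
  · simp [h]
  · exact (g.pos x u h).le

namespace FramedPhiStructure

variable (C : FramedPhiStructure g s)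

theorem mdifferentiableAt_φ {Y : Π x : M, TangentSpace I x} {x : M} (hY : MDiffAt (T% Y) x) :
    MDiffAt (T% (fun y => C.φ y (Y y))) x := by
  apply MDifferentiableAt.clm_bundle_apply (F₁ := E) (F₂ := E)
  · exact (C.φ_smooth x).mdifferentiableAt (by simp)
  · exact hY

theorem mdifferentiableAt_ξ (α : Fin s) (x : M) : MDiffAt (T% (C.ξ α)) x :=
  (C.ξ_smooth α x).mdifferentiableAt (by simp)

/-- `φ` is skew-adjoint. -/
theorem inner_φ_left (x : M) (u v : TangentSpace I x) :
    g.inner x (C.φ x u) v = -g.inner x u (C.φ x v) := by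
  have h1 := C.g_φ_φ x u (C.φ x v)
  rw [C.φ_sq] at h1
  simp [C.η_φ] at h1
  have h2 : ∀ α, g.inner x (C.φ x u) (C.ξ α x) = 0 := fun α => by rw [← C.η_eq, C.η_φ]
  simp [h2] at h1
  linarith

variable {θ : Fin s → ℝ}

theorem inner_slantField (x : M) (u : TangentSpace I x) :
    g.inner x u (C.slantField θ x) = ∑ α, Real.cos (θ α) * C.η α x u := by
  simp [slantField, C.η_eq]

theorem η_slantField (x : M) (α : Fin s) : C.η α x (C.slantField θ x) = Real.cos (θ α) := by
  simp [slantField, C.η_ξ]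

theorem φ_slantField (x : M) : C.φ x (C.slantField θ x) = 0 := by
  simp [slantField, C.φ_ξ]

theorem inner_self_φ (x : M) (u : TangentSpace I x) : g.inner x u (C.φ x u) = 0 := by
  linarith [C.inner_φ_left x u u, g.symm x u (C.φ x u)]

variable [FiniteDimensional ℝ E]

theorem tensorialAt_φ (x : M) :
    TensorialAt I E (fun Y : Π y : M, TangentSpace I y =>
      leviCivita g (fun y => C.φ y (Y y)) x - (C.φ x).comp (leviCivita g Y x)) x where
  smul {f Y} hf hY := by
    have h1 := (leviCivita g).isCovariantDerivativeOnUniv.leibniz hY hf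
    have h2 := (leviCivita g).isCovariantDerivativeOnUniv.leibniz (C.mdifferentiableAt_φ hY) hf
    have h3 : (fun y => C.φ y ((f • Y) y)) = f • (fun y => C.φ y (Y y)) := by
      ext y; simp
    rw [h3, h1, h2]
    ext u
    simp
    module
  add {Y Y'} hY hY' := by
    have h1 := (leviCivita g).isCovariantDerivativeOnUniv.add hY hY'
    have h2 := (leviCivita g).isCovariantDerivativeOnUniv.add (C.mdifferentiableAt_φ hY)
      (C.mdifferentiableAt_φ hY')
    have h3 : (fun y => C.φ y ((Y + Y') y)) =
      (fun y => C.φ y (Y y)) + (fun y => C.φ y (Y' y)) := by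
      ext y; simp
    rw [h3, h1, h2]
    ext u
    simp
    module

/-- The covariant derivative of the tensor field `φ`: `covDerivφ x v u` is `(∇_u φ) v`, with the
direction of differentiation as the last argument, as in `leviCivita`. -/
noncomputable def covDerivφ (x : M) :
    TangentSpace I x →L[ℝ] TangentSpace I x →L[ℝ] TangentSpace I x :=
  TensorialAt.mkHom _ x (C.tensorialAt_φ x)

theorem covDerivφ_apply {Y : Π x : M, TangentSpace I x} {x : M} (hY : MDiffAt (T% Y) x)
    (u : TangentSpace I x) :
    C.covDerivφ x (Y x) u = leviCivita g (fun y => C.φ y (Y y)) x u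
      - C.φ x (leviCivita g Y x u) := by
  rw [covDerivφ, TensorialAt.mkHom_apply _ hY]
  rfl

theorem inner_covDerivφ_skew (x : M) (u v w : TangentSpace I x) :
    g.inner x (C.covDerivφ x v u) w = -g.inner x (C.covDerivφ x w u) v := by
  have hU := mdifferentiableAt_extend I E u
  have hV := mdifferentiableAt_extend I E v
  have hW := mdifferentiableAt_extend I E w
  have h1 := (isLeviCivita_leviCivita g).2 x _ _ _ hU (C.mdifferentiableAt_φ hV) hW
  have h2 := (isLeviCivita_leviCivita g).2 x _ _ _ hU hV (C.mdifferentiableAt_φ hW)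
  have h3 := C.covDerivφ_apply hV u
  have h4 := C.covDerivφ_apply hW u
  have h5 : (fun y => g.inner y (C.φ y (extend E v y)) (extend E w y)) =
      -(fun y => g.inner y (extend E v y) (C.φ y (extend E w y))) := by
    ext y; simp [C.inner_φ_left]
  rw [h5, mvfderiv_neg] at h1
  simp only [extend_apply_self, _root_.neg_apply] at h1 h2 h3 h4
  rw [h3, h4]
  simp only [map_sub, _root_.sub_apply]
  linarith [C.inner_φ_left x (leviCivita g (extend E v) x u) w,
    C.inner_φ_left x (leviCivita g (extend E w) x u) v,
    C.inner_φ_left x v (leviCivita g (extend E w) x u),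
    g.symm x v (C.φ x (leviCivita g (extend E w) x u)),
    g.symm x v (leviCivita g (fun y => C.φ y (extend E w y)) x u)]

theorem inner_covDerivφ_ξ (α : Fin s) (x : M) (u w : TangentSpace I x) :
    g.inner x (C.covDerivφ x (C.ξ α x) u) w =
      g.inner x (leviCivita g (C.ξ α) x u) (C.φ x w) := by
  rw [C.covDerivφ_apply (C.mdifferentiableAt_ξ α x)]
  have h1 : (fun y => C.φ y (C.ξ α y)) = 0 := by ext y; simp [C.φ_ξ]
  rw [h1, (leviCivita g).isCovariantDerivativeOnUniv.zero]
  simp [C.inner_φ_left]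

theorem inner_covDeriv_ξ_skew (α β : Fin s) (x : M) (u : TangentSpace I x) :
    g.inner x (leviCivita g (C.ξ α) x u) (C.ξ β x) =
      -g.inner x (leviCivita g (C.ξ β) x u) (C.ξ α x) := by
  have h1 := (isLeviCivita_leviCivita g).2 x _ _ _ (mdifferentiableAt_extend I E u)
    (C.mdifferentiableAt_ξ α x) (C.mdifferentiableAt_ξ β x)
  have h2 : (fun y => g.inner y (C.ξ α y) (C.ξ β y)) =
      fun _ => if β = α then (1 : ℝ) else 0 := by
    ext y; rw [← C.η_eq, C.η_ξ]
  rw [h2, mvfderiv_const] at h1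
  simp only [extend_apply_self, _root_.zero_apply] at h1
  linarith [g.symm x (C.ξ α x) (leviCivita g (C.ξ β) x u)]

namespace IsCManifold

variable {C}

/-- `dη^α = 0` in terms of the Levi-Civita connection. -/
theorem inner_covDeriv_ξ_symm (hC : C.IsCManifold) (α : Fin s) (x : M)
    (u v : TangentSpace I x) :
    g.inner x (leviCivita g (C.ξ α) x u) v = g.inner x (leviCivita g (C.ξ α) x v) u := by
  have hU := mdifferentiableAt_extend I E u
  have hV := mdifferentiableAt_extend I E v
  have hξ := C.mdifferentiableAt_ξ α x
  have h := hC.d_η α x _ _ hU hV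
  simp only [extDerivOne, C.η_eq] at h
  rw [(isLeviCivita_leviCivita g).2 x _ _ _ hU hV hξ,
    (isLeviCivita_leviCivita g).2 x _ _ _ hV hU hξ,
    ← (isLeviCivita_leviCivita g).1 x _ _ hU hV] at h
  simp only [extend_apply_self, map_sub, _root_.sub_apply] at h
  linarith [g.symm x v (leviCivita g (C.ξ α) x u), g.symm x u (leviCivita g (C.ξ α) x v)]

/-- `dΩ = 0` in terms of the Levi-Civita connection. -/
theorem inner_covDerivφ_cyclic (hC : C.IsCManifold) (x : M) (u v w : TangentSpace I x) :
    g.inner x (C.covDerivφ x v u) w + g.inner x (C.covDerivφ x w v) u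
      + g.inner x (C.covDerivφ x u w) v = 0 := by
  have hU := mdifferentiableAt_extend I E u
  have hV := mdifferentiableAt_extend I E v
  have hW := mdifferentiableAt_extend I E w
  have h := hC.d_fundamentalForm x _ _ _ hU hV hW
  have a1 := C.covDerivφ_apply hU v
  have a2 := C.covDerivφ_apply hV w
  have a3 := C.covDerivφ_apply hW u
  simp only [extDerivTwo, fundamentalForm] at h
  rw [(isLeviCivita_leviCivita g).2 x _ _ _ hU hV (C.mdifferentiableAt_φ hW),
    (isLeviCivita_leviCivita g).2 x _ _ _ hV hW (C.mdifferentiableAt_φ hU),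
    (isLeviCivita_leviCivita g).2 x _ _ _ hW hU (C.mdifferentiableAt_φ hV),
    ← (isLeviCivita_leviCivita g).1 x _ _ hU hV, ← (isLeviCivita_leviCivita g).1 x _ _ hV hW,
    ← (isLeviCivita_leviCivita g).1 x _ _ hW hU] at h
  simp only [extend_apply_self] at h a1 a2 a3
  simp only [map_sub, _root_.sub_apply] at h
  rw [C.inner_covDerivφ_skew x u v w, C.inner_covDerivφ_skew x v w u,
    C.inner_covDerivφ_skew x w u v, a1, a2, a3]
  simp only [map_sub, _root_.sub_apply, C.inner_φ_left]
  linarith [g.symm x v (leviCivita g (fun y => C.φ y (extend E w y)) x u),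
    g.symm x w (leviCivita g (fun y => C.φ y (extend E u y)) x v),
    g.symm x u (leviCivita g (fun y => C.φ y (extend E v y)) x w)]

/-- `N_φ = 0` in terms of the Levi-Civita connection; normality reduces to it as `dη^α = 0`. -/
theorem covDerivφ_normal (hC : C.IsCManifold) (x : M) (u v : TangentSpace I x) :
    C.covDerivφ x v (C.φ x u) - C.covDerivφ x u (C.φ x v)
      + C.φ x (C.covDerivφ x u v) - C.φ x (C.covDerivφ x v u) = 0 := by
  have hU := mdifferentiableAt_extend I E u
  have hV := mdifferentiableAt_extend I E v
  have hφU := C.mdifferentiableAt_φ hU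
  have hφV := C.mdifferentiableAt_φ hV
  have h := hC.normal x _ _ hU hV
  simp only [hC.d_η _ x _ _ hU hV, nijenhuis, zero_smul, Finset.sum_const_zero, smul_zero,
    neg_zero] at h
  rw [← (isLeviCivita_leviCivita g).1 x _ _ hU hV, ← (isLeviCivita_leviCivita g).1 x _ _ hφU hV,
    ← (isLeviCivita_leviCivita g).1 x _ _ hU hφV,
    ← (isLeviCivita_leviCivita g).1 x _ _ hφU hφV] at h
  have a1 := C.covDerivφ_apply hU v
  have a2 := C.covDerivφ_apply hV u
  have a3 := C.covDerivφ_apply hU (C.φ x v)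
  have a4 := C.covDerivφ_apply hV (C.φ x u)
  simp only [extend_apply_self] at h a1 a2 a3 a4
  rw [← h, a1, a2, a3, a4]
  simp only [map_sub]
  abel

/-- On a `C`-manifold `φ` and the `ξ_α` are parallel. -/
theorem parallel (hC : C.IsCManifold) (x : M) :
    (∀ u v, C.covDerivφ x v u = 0) ∧ ∀ α u, leviCivita g (C.ξ α) x u = 0 := by
  let G : TangentSpace I x →ₗ[ℝ] TangentSpace I x →ₗ[ℝ] ℝ :=
    LinearMap.mk₂ ℝ (fun u w => g.inner x u w) (by simp) (by simp) (by simp) (by simp)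
  have hG : ∀ u, (∀ w, g.inner x u w = 0) → u = 0 := by
    intro u hu
    by_contra h
    exact (g.pos x u h).ne' (hu u)
  let D : TangentSpace I x →ₗ[ℝ] TangentSpace I x →ₗ[ℝ] TangentSpace I x :=
    LinearMap.mk₂ ℝ (fun u v => C.covDerivφ x v u) (by simp) (by simp) (by simp) (by simp)
  have h := parallel_of_normal_closed (C.φ x).toLinearMap (fun α => C.ξ α x) (fun α => C.η α x)
    (D.compr₂ G) (fun α => G ∘ₗ (leviCivita g (C.ξ α) x).toLinearMap) (C.φ_sq x) (C.φ_ξ x)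
    (C.inner_covDerivφ_skew x) (hC.inner_covDerivφ_cyclic x) ?_
    (fun α u w => C.inner_covDerivφ_ξ α x u w) (fun α u v => hC.inner_covDeriv_ξ_symm α x u v)
    (fun α β u => C.inner_covDeriv_ξ_skew α β x u)
  · exact ⟨fun u v => hG _ (h.1 u v), fun α u => hG _ (h.2 α u)⟩
  · intro u v w
    change g.inner x (C.covDerivφ x v (C.φ x u)) w - g.inner x (C.covDerivφ x u (C.φ x v)) w
      + g.inner x (C.covDerivφ x v u) (C.φ x w) - g.inner x (C.covDerivφ x u v) (C.φ x w) = 0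
    have h := congrArg (fun z => g.inner x z w) (hC.covDerivφ_normal x u v)
    simp only [map_sub, map_add, _root_.sub_apply, _root_.add_apply, C.inner_φ_left,
      map_zero, _root_.zero_apply] at h
    linarith

end IsCManifold

end FramedPhiStructure
end Parallel

/-! ### Covariant differentiation along curves -/

section ChainRule

variable {E : Type*} [NormedAddCommGroup E] [NormedSpace ℝ E]
  {H : Type*} [TopologicalSpace H] {I : ModelWithCorners ℝ E H}
  {M : Type*} [TopologicalSpace M] [ChartedSpace H M] {γ : ℝ → M} {t₀ : ℝ}

theorem mvfderiv_congr {F : Type*} [NormedAddCommGroup F] [NormedSpace ℝ F] {f h : M → F} {x : M}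
    (hfh : f =ᶠ[𝓝 x] h) : d% f x = d% h x := by
  unfold mvfderiv
  rw [hfh.mfderiv_eq]
  rfl

/-- The chain rule for a function on `M` along a curve. -/
theorem hasDerivAt_comp_mvfderiv {F : Type*} [NormedAddCommGroup F] [NormedSpace ℝ F] {f : M → F}
    (hf : MDiffAt f (γ t₀)) (hγ : MDifferentiableAt 𝓘(ℝ, ℝ) I γ t₀) :
    HasDerivAt (fun t => f (γ t)) (d% f (γ t₀) (velocity I γ t₀)) t₀ := by
  have h : DifferentiableAt ℝ (fun t => f (γ t)) t₀ :=
    mdifferentiableAt_iff_differentiableAt.1 (hf.comp t₀ hγ)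
  convert h.hasDerivAt using 1
  rw [← fderiv_apply_one_eq_deriv, ← mfderiv_eq_fderiv]
  exact (mfderiv_comp_apply t₀ hf hγ _).symm

end ChainRule

section AlongCurves

variable {E : Type*} [NormedAddCommGroup E] [NormedSpace ℝ E]
  {H : Type*} [TopologicalSpace H] {I : ModelWithCorners ℝ E H}
  {M : Type*} [TopologicalSpace M] [ChartedSpace H M] [IsManifold I ∞ M]

/-- The components of a tangent vector `v` at `y` in the trivialization of the tangent bundle around
`x`. They are meaningful only for `y` in the base set of that trivialization. -/
noncomputable def coords (x : M) {y : M} (v : TangentSpace I y) : E :=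
  (trivializationAt E (TangentSpace I : M → Type _) x (⟨y, v⟩ : TangentBundle I M)).2

theorem coords_add {x y : M} (hy : y ∈ (trivializationAt E (TangentSpace I : M → Type _) x).baseSet)
    (v w : TangentSpace I y) : coords x (v + w) = coords x v + coords x w :=
  ((trivializationAt E (TangentSpace I : M → Type _) x).linear ℝ hy).map_add v w

theorem coords_smul {x y : M}
    (hy : y ∈ (trivializationAt E (TangentSpace I : M → Type _) x).baseSet)
    (c : ℝ) (w : TangentSpace I y) : coords x (c • w) = c • coords x w :=
  ((trivializationAt E (TangentSpace I : M → Type _) x).linear ℝ hy).map_smul c w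

variable (I) in
/-- The field `V` along `γ` is differentiable at `t₀`, as a curve in the tangent bundle. -/
def MDiffAlongAt (γ : ℝ → M) (V : Π t : ℝ, TangentSpace I (γ t)) (t₀ : ℝ) : Prop :=
  MDifferentiableAt 𝓘(ℝ, ℝ) I.tangent (fun t => (⟨γ t, V t⟩ : TangentBundle I M)) t₀

variable {γ : ℝ → M} {V W : Π t : ℝ, TangentSpace I (γ t)} {t₀ : ℝ}

theorem mdiffAlongAt_iff : MDiffAlongAt I γ V t₀ ↔
    MDifferentiableAt 𝓘(ℝ, ℝ) I γ t₀ ∧ DifferentiableAt ℝ (fun t => coords (γ t₀) (V t)) t₀ := by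
  rw [MDiffAlongAt, mdifferentiableAt_totalSpace, mdifferentiableAt_iff_differentiableAt]
  rfl

theorem eventually_mem_baseSet (hγ : MDifferentiableAt 𝓘(ℝ, ℝ) I γ t₀) :
    ∀ᶠ t in 𝓝 t₀, γ t ∈ (trivializationAt E (TangentSpace I : M → Type _) (γ t₀)).baseSet :=
  hγ.continuousAt.eventually_mem ((trivializationAt E (TangentSpace I : M → Type _)
    (γ t₀)).open_baseSet.mem_nhds (mem_baseSet_trivializationAt' _))

theorem MDiffAlongAt.add (hV : MDiffAlongAt I γ V t₀) (hW : MDiffAlongAt I γ W t₀) :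
    MDiffAlongAt I γ (fun t => V t + W t) t₀ := by
  rw [mdiffAlongAt_iff] at *
  refine ⟨hV.1, (hV.2.add hW.2).congr_of_eventuallyEq ?_⟩
  filter_upwards [eventually_mem_baseSet hV.1] with t ht
  exact coords_add ht _ _

theorem MDiffAlongAt.smul {f : ℝ → ℝ} (hf : DifferentiableAt ℝ f t₀)
    (hV : MDiffAlongAt I γ V t₀) :
    MDiffAlongAt I γ (fun t => f t • V t) t₀ := by
  rw [mdiffAlongAt_iff] at *
  refine ⟨hV.1, (hf.smul hV.2).congr_of_eventuallyEq ?_⟩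
  filter_upwards [eventually_mem_baseSet hV.1] with t ht
  exact coords_smul ht _ _

theorem mdiffAlongAt_comp {X : Π x : M, TangentSpace I x} (hX : MDiffAt (T% X) (γ t₀))
    (hγ : MDifferentiableAt 𝓘(ℝ, ℝ) I γ t₀) : MDiffAlongAt I γ (fun t => X (γ t)) t₀ :=
  hX.comp t₀ hγ

theorem symm_add {x y : M} (hy : y ∈ (trivializationAt E (TangentSpace I : M → Type _) x).baseSet)
    (v w : E) :
    (trivializationAt E (TangentSpace I : M → Type _) x).symm y (v + w) =
      (trivializationAt E (TangentSpace I : M → Type _) x).symm y v +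
      (trivializationAt E (TangentSpace I : M → Type _) x).symm y w := by
  simp only [← Trivialization.coe_symmₗ (R := ℝ) _ hy]
  exact map_add _ _ _

theorem symm_smul {x y : M} (hy : y ∈ (trivializationAt E (TangentSpace I : M → Type _) x).baseSet)
    (c : ℝ) (v : E) :
    (trivializationAt E (TangentSpace I : M → Type _) x).symm y (c • v) =
      c • (trivializationAt E (TangentSpace I : M → Type _) x).symm y v := by
  simp only [← Trivialization.coe_symmₗ (R := ℝ) _ hy]
  exact map_smul _ _ _

theorem eventually_mem_baseSet_self (x : M) :
    ∀ᶠ y in 𝓝 x, y ∈ (trivializationAt E (TangentSpace I : M → Type _) x).baseSet :=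
  (trivializationAt E (TangentSpace I : M → Type _) x).open_baseSet.mem_nhds
    (mem_baseSet_trivializationAt' x)

theorem symm_coords (x : M) (v : TangentSpace I x) :
    (trivializationAt E (TangentSpace I) x).symm x (coords x v) = v :=
  extend_apply_self E v

variable [FiniteDimensional ℝ E]
  (g : ContMDiffRiemannianMetric I ∞ E (fun x : M => TangentSpace I x))

theorem covDerivAlong_congr (h : ∀ᶠ t in 𝓝 t₀, V t = W t) :
    covDerivAlong g γ V t₀ = covDerivAlong g γ W t₀ := by
  have h1 : (fun t => coords (γ t₀) (V t)) =ᶠ[𝓝 t₀] fun t => coords (γ t₀) (W t) :=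
    h.mono fun t ht => by simp only [ht]
  unfold covDerivAlong
  rw [h.self_of_nhds]
  congr 2
  exact h1.deriv_eq

/-- The fields `extend E v` depend linearly on `v` only near `x`, as `extend` takes arbitrary values
off the base set of the trivialization; `∇` sees only the germ. -/
theorem leviCivita_extend_add {x : M} (v w : TangentSpace I x) :
    leviCivita g (extend E (v + w)) x =
      leviCivita g (extend E v) x + leviCivita g (extend E w) x := by
  have hv := mdifferentiableAt_extend I E v
  have hw := mdifferentiableAt_extend I E w
  rw [← (leviCivita g).isCovariantDerivativeOnUniv.add hv hw]
  refine (leviCivita g).isCovariantDerivativeOnUniv.congr_of_eventuallyEq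
    (mdifferentiableAt_extend ..) (mdifferentiableAt_add_section hv hw) Filter.univ_mem ?_
  filter_upwards [eventually_mem_baseSet_self (E := E) (I := I) x] with y hy
  change Trivialization.symm _ _ (coords x (v + w)) = _
  rw [coords_add (mem_baseSet_trivializationAt' x)]
  exact symm_add hy _ _

theorem leviCivita_extend_smul {x : M} (c : ℝ) (v : TangentSpace I x) :
    leviCivita g (extend E (c • v)) x = c • leviCivita g (extend E v) x := by
  have hv := mdifferentiableAt_extend I E v
  rw [← (leviCivita g).isCovariantDerivativeOnUniv.smul_const c hv]
  refine (leviCivita g).isCovariantDerivativeOnUniv.congr_of_eventuallyEq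
    (mdifferentiableAt_extend ..) hv.smul_const_section Filter.univ_mem ?_
  filter_upwards [eventually_mem_baseSet_self (E := E) (I := I) x] with y hy
  change Trivialization.symm _ _ (coords x (c • v)) = _
  rw [coords_smul (mem_baseSet_trivializationAt' x)]
  exact symm_smul hy _ _

theorem covDerivAlong_add (hV : MDiffAlongAt I γ V t₀) (hW : MDiffAlongAt I γ W t₀) :
    covDerivAlong g γ (fun t => V t + W t) t₀ =
      covDerivAlong g γ V t₀ + covDerivAlong g γ W t₀ := by
  rw [mdiffAlongAt_iff] at *
  have h1 : deriv (fun t => coords (γ t₀) (V t + W t)) t₀ =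
      deriv (fun t => coords (γ t₀) (V t)) t₀ + deriv (fun t => coords (γ t₀) (W t)) t₀ := by
    rw [← deriv_add hV.2 hW.2]
    refine Filter.EventuallyEq.deriv_eq ?_
    filter_upwards [eventually_mem_baseSet hV.1] with t ht
    exact coords_add ht _ _
  unfold covDerivAlong
  change Trivialization.symm _ _ (deriv (fun t => coords (γ t₀) (V t + W t)) t₀) + _ =
    Trivialization.symm _ _ (deriv (fun t => coords (γ t₀) (V t)) t₀) + _ +
    (Trivialization.symm _ _ (deriv (fun t => coords (γ t₀) (W t)) t₀) + _)
  rw [h1, leviCivita_extend_add, symm_add (mem_baseSet_trivializationAt' _)]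
  simp only [_root_.add_apply]
  exact add_add_add_comm _ _ _ _

theorem covDerivAlong_smul {f : ℝ → ℝ} (hf : DifferentiableAt ℝ f t₀)
    (hV : MDiffAlongAt I γ V t₀) :
    covDerivAlong g γ (fun t => f t • V t) t₀ =
      f t₀ • covDerivAlong g γ V t₀ + deriv f t₀ • V t₀ := by
  rw [mdiffAlongAt_iff] at *
  have h1 : deriv (fun t => coords (γ t₀) (f t • V t)) t₀ =
      f t₀ • deriv (fun t => coords (γ t₀) (V t)) t₀ + deriv f t₀ • coords (γ t₀) (V t₀) := by
    rw [← deriv_fun_smul hf hV.2]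
    refine Filter.EventuallyEq.deriv_eq ?_
    filter_upwards [eventually_mem_baseSet hV.1] with t ht
    exact coords_smul ht _ _
  unfold covDerivAlong
  change Trivialization.symm _ _ (deriv (fun t => coords (γ t₀) (f t • V t)) t₀) + _ =
    f t₀ • (Trivialization.symm _ _ (deriv (fun t => coords (γ t₀) (V t)) t₀) + _) + _
  rw [h1, leviCivita_extend_smul, symm_add (mem_baseSet_trivializationAt' _),
    symm_smul (mem_baseSet_trivializationAt' _), symm_smul (mem_baseSet_trivializationAt' _),
    symm_coords]
  simp only [_root_.smul_apply]
  module

theorem covDerivAlong_const_smul (c : ℝ)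
    (hV : MDiffAlongAt I γ V t₀) :
    covDerivAlong g γ (fun t => c • V t) t₀ = c • covDerivAlong g γ V t₀ := by
  rw [covDerivAlong_smul g (differentiableAt_const c) hV]
  simp

/-- The covariant derivative along `γ` of the restriction of a vector field on `M`. -/
theorem covDerivAlong_comp {X : Π x : M, TangentSpace I x} (hX : MDiffAt (T% X) (γ t₀))
    (hγ : MDifferentiableAt 𝓘(ℝ, ℝ) I γ t₀) :
    covDerivAlong g γ (fun t => X (γ t)) t₀ = leviCivita g X (γ t₀) (velocity I γ t₀) := by
  set u := velocity I γ t₀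
  set e := trivializationAt E (TangentSpace I : M → Type _) (γ t₀)
  have he : ∀ᶠ y in 𝓝 (γ t₀), y ∈ e.baseSet := eventually_mem_baseSet_self _
  have hp : γ t₀ ∈ e.baseSet := he.self_of_nhds
  have hcoords : ∀ {Y : Π x : M, TangentSpace I x}, MDiffAt (T% Y) (γ t₀) →
      MDiffAt (fun y => coords (γ t₀) (Y y)) (γ t₀) := fun hY =>
    (mdifferentiableAt_section _ _).1 hY
  -- The derivative of the components is the flat connection of the trivialization; its difference
  -- with `∇` is tensorial, so that `X` may be replaced by the constant field through `X (γ t₀)`.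
  have hT : TensorialAt I E (fun Y : Π x : M, TangentSpace I x => leviCivita g Y (γ t₀) u
      - e.symm (γ t₀) (d% (fun y => coords (γ t₀) (Y y)) (γ t₀) u)) (γ t₀) := by
    constructor
    · intro f Y hf hY
      have h1 : d% (fun y => coords (γ t₀) ((f • Y) y)) (γ t₀) =
          d% (f • fun y => coords (γ t₀) (Y y)) (γ t₀) := by
        refine mvfderiv_congr ?_
        filter_upwards [he] with y hy
        exact coords_smul hy _ _
      rw [h1, mvfderiv_smul hf (hcoords hY),
        (leviCivita g).isCovariantDerivativeOnUniv.leibniz hY hf]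
      simp only [_root_.add_apply, _root_.smul_apply, ContinuousLinearMap.smulRight_apply]
      rw [symm_add hp, symm_smul hp, symm_smul hp, symm_coords]
      module
    · intro Y Z hY hZ
      have h1 : d% (fun y => coords (γ t₀) ((Y + Z) y)) (γ t₀) =
          d% ((fun y => coords (γ t₀) (Y y)) + fun y => coords (γ t₀) (Z y)) (γ t₀) := by
        refine mvfderiv_congr ?_
        filter_upwards [he] with y hy
        exact coords_add hy _ _
      rw [h1, mvfderiv_add (hcoords hY) (hcoords hZ),
        (leviCivita g).isCovariantDerivativeOnUniv.add hY hZ]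
      simp only [_root_.add_apply]
      rw [symm_add hp]
      module
  have h1 := hT.pointwise hX (mdifferentiableAt_extend I E (X (γ t₀))) (by simp)
  have h2 : d% (fun y => coords (γ t₀) (extend E (X (γ t₀)) y)) (γ t₀) =
      d% (fun _ : M => coords (γ t₀) (X (γ t₀))) (γ t₀) := by
    refine mvfderiv_congr ?_
    filter_upwards [he] with y hy
    change (e ⟨y, e.symm y (coords (γ t₀) (X (γ t₀)))⟩).2 = _
    rw [e.apply_mk_symm hy]
  have h3 := (hasDerivAt_comp_mvfderiv (hcoords hX) hγ).deriv
  simp only [h2, mvfderiv_const, _root_.zero_apply] at h1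
  unfold covDerivAlong
  change e.symm _ (deriv (fun t => coords (γ t₀) (X (γ t))) t₀) + _ = _
  have h4 : e.symm (γ t₀) 0 = (0 : TangentSpace I (γ t₀)) := by
    simpa using symm_smul hp 0 0
  rw [h3]
  rw [h4, sub_zero] at h1
  rw [← h1]
  abel

/-- A differentiable field along `γ` is locally a combination, with coefficients depending on the
parameter, of restrictions of vector fields on `M` (those of a local frame). -/
theorem MDiffAlongAt.exists_eq_sum (hV : MDiffAlongAt I γ V t₀) :
    ∃ (f : Module.Basis.ofVectorSpaceIndex ℝ E → ℝ → ℝ)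
      (X : Module.Basis.ofVectorSpaceIndex ℝ E → Π x : M, TangentSpace I x),
      (∀ i, DifferentiableAt ℝ (f i) t₀) ∧ (∀ i, MDiffAt (T% (X i)) (γ t₀)) ∧
      ∀ᶠ t in 𝓝 t₀, V t = ∑ i, f i t • X i (γ t) := by
  let b := Module.Basis.ofVectorSpace ℝ E
  let e := trivializationAt E (TangentSpace I : M → Type _) (γ t₀)
  have h := mdiffAlongAt_iff.1 hV
  refine ⟨fun i t => b.repr (coords (γ t₀) (V t)) i, e.localFrame b, fun i => ?_, fun i => ?_, ?_⟩
  · exact (LinearMap.toContinuousLinearMap (b.coord i)).differentiableAt.comp t₀ h.2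
  · exact (contMDiffAt_localFrame_of_mem 1 _ b i
      (mem_baseSet_trivializationAt' _)).mdifferentiableAt (by simp)
  · filter_upwards [eventually_mem_baseSet h.1] with t ht
    have h1 := e.eq_sum_localFrameCoeff_smul (I := I) (b := b) (s := extend E (V t)) ht
    have h2 := e.localFrameCoeff_apply_of_mem_baseSet (I := I) b ht (extend E (V t))
    rw [extend_apply_self] at h1 h2
    rw [h1]
    exact Finset.sum_congr rfl fun i _ => by rw [← h1, h2]; rfl

/-- `∇_{γ'}` of `∑ f_i • X_i ∘ γ`. -/
theorem covDerivAlong_sum {ι : Type*} (S : Finset ι) {f : ι → ℝ → ℝ}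
    {X : ι → Π x : M, TangentSpace I x} (hγ : MDifferentiableAt 𝓘(ℝ, ℝ) I γ t₀)
    (hf : ∀ i, DifferentiableAt ℝ (f i) t₀) (hX : ∀ i, MDiffAt (T% (X i)) (γ t₀)) :
    MDiffAlongAt I γ (fun t => ∑ i ∈ S, f i t • X i (γ t)) t₀ ∧
    covDerivAlong g γ (fun t => ∑ i ∈ S, f i t • X i (γ t)) t₀ =
      ∑ i ∈ S, (f i t₀ • leviCivita g (X i) (γ t₀) (velocity I γ t₀)
        + deriv (f i) t₀ • X i (γ t₀)) := by
  classical
  have h0 : ∀ i, MDiffAlongAt I γ (fun t => f i t • X i (γ t)) t₀ := fun i =>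
    (mdiffAlongAt_comp (hX i) hγ).smul (hf i)
  induction S using Finset.induction_on with
  | empty =>
    have h1 : MDiffAlongAt I γ (fun t => (0 : TangentSpace I (γ t))) t₀ :=
      mdiffAlongAt_comp (mdifferentiableAt_zeroSection ..) hγ
    refine ⟨by simpa using h1, ?_⟩
    have h2 := covDerivAlong_smul g (f := fun _ => 0) (differentiableAt_const _) h1
    simpa using h2
  | insert i S hi ih =>
    simp only [Finset.sum_insert hi]
    refine ⟨(h0 i).add ih.1, ?_⟩
    rw [covDerivAlong_add g (h0 i) ih.1, ih.2, covDerivAlong_smul g (hf i)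
      (mdiffAlongAt_comp (hX i) hγ), covDerivAlong_comp g (hX i) hγ]

/-- Compatibility of `∇_{γ'}` with the metric, when one of the two fields along `γ` is the
restriction of a vector field on `M`. -/
theorem hasDerivAt_inner_comp {Z : Π x : M, TangentSpace I x} (hV : MDiffAlongAt I γ V t₀)
    (hZ : MDiffAt (T% Z) (γ t₀)) :
    HasDerivAt (fun t => g.inner (γ t) (V t) (Z (γ t)))
      (g.inner (γ t₀) (covDerivAlong g γ V t₀) (Z (γ t₀)) +
        g.inner (γ t₀) (V t₀) (leviCivita g Z (γ t₀) (velocity I γ t₀))) t₀ := by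
  obtain ⟨f, X, hf, hX, hVX⟩ := hV.exists_eq_sum
  have hγ := (mdiffAlongAt_iff.1 hV).1
  have h1 : (fun t => g.inner (γ t) (V t) (Z (γ t))) =ᶠ[𝓝 t₀]
      fun t => ∑ i, f i t * g.inner (γ t) (X i (γ t)) (Z (γ t)) := by
    filter_upwards [hVX] with t ht
    rw [ht]
    simp
  refine HasDerivAt.congr_of_eventuallyEq ?_ h1
  have h2 : ∀ i, HasDerivAt (fun t => g.inner (γ t) (X i (γ t)) (Z (γ t)))
      (g.inner (γ t₀) (leviCivita g (X i) (γ t₀) (velocity I γ t₀)) (Z (γ t₀)) +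
        g.inner (γ t₀) (X i (γ t₀)) (leviCivita g Z (γ t₀) (velocity I γ t₀))) t₀ := by
    intro i
    have h3 := (isLeviCivita_leviCivita g).2 (γ t₀) _ _ _
      (mdifferentiableAt_extend I E (velocity I γ t₀)) (hX i) hZ
    rw [extend_apply_self] at h3
    rw [← h3]
    exact hasDerivAt_comp_mvfderiv (mdiff_inner g (hX i) hZ) hγ
  refine (HasDerivAt.fun_sum fun i _ => (hf i).hasDerivAt.mul (h2 i)).congr_deriv ?_
  rw [covDerivAlong_congr g hVX, (covDerivAlong_sum g _ hγ hf hX).2, hVX.self_of_nhds]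
  simp only [map_sum, map_add, map_smul, _root_.sum_apply, _root_.add_apply, _root_.smul_apply,
    smul_eq_mul, ← Finset.sum_add_distrib]
  exact Finset.sum_congr rfl fun i _ => by ring

theorem FramedPhiStructure.covDerivAlong_φ {s : ℕ}
    {g : ContMDiffRiemannianMetric I ∞ E (fun x : M => TangentSpace I x)}
    (C : FramedPhiStructure g s) (hV : MDiffAlongAt I γ V t₀) :
    covDerivAlong g γ (fun t => C.φ (γ t) (V t)) t₀ =
      C.φ (γ t₀) (covDerivAlong g γ V t₀) + C.covDerivφ (γ t₀) (V t₀) (velocity I γ t₀) := by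
  obtain ⟨f, X, hf, hX, hVX⟩ := hV.exists_eq_sum
  have hγ := (mdiffAlongAt_iff.1 hV).1
  have h1 : ∀ᶠ t in 𝓝 t₀, C.φ (γ t) (V t) = ∑ i, f i t • C.φ (γ t) (X i (γ t)) := by
    filter_upwards [hVX] with t ht
    rw [ht]
    simp
  rw [covDerivAlong_congr g h1, covDerivAlong_congr g hVX, (covDerivAlong_sum g _ hγ hf hX).2,
    (covDerivAlong_sum g _ hγ hf fun i => C.mdifferentiableAt_φ (hX i)).2, hVX.self_of_nhds]
  simp only [map_sum, map_add, map_smul, _root_.sum_apply, _root_.smul_apply,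
    C.covDerivφ_apply (hX _), ← Finset.sum_add_distrib]
  exact Finset.sum_congr rfl fun i _ => by module

end AlongCurves

/-! ### Smooth fields along curves -/

section SmoothAlong

variable {E : Type*} [NormedAddCommGroup E] [NormedSpace ℝ E]
  {H : Type*} [TopologicalSpace H] {I : ModelWithCorners ℝ E H}
  {M : Type*} [TopologicalSpace M] [ChartedSpace H M] [IsManifold I ∞ M]

variable (I) in
/-- The field `V` along `γ` is smooth on `J`, as a curve in the tangent bundle. -/
def SmoothAlongOn (γ : ℝ → M) (V : Π t : ℝ, TangentSpace I (γ t)) (J : Set ℝ) : Prop :=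
  ContMDiffOn 𝓘(ℝ, ℝ) I.tangent ∞ (fun t => (⟨γ t, V t⟩ : TangentBundle I M)) J

variable {γ : ℝ → M} {V W : Π t : ℝ, TangentSpace I (γ t)} {J : Set ℝ}

theorem contMDiffWithinAt_along_iff {t₀ : ℝ} :
    ContMDiffWithinAt 𝓘(ℝ, ℝ) I.tangent ∞ (fun t => (⟨γ t, V t⟩ : TangentBundle I M)) J t₀ ↔
    ContMDiffWithinAt 𝓘(ℝ, ℝ) I ∞ γ J t₀ ∧
      ContDiffWithinAt ℝ ∞ (fun t => coords (γ t₀) (V t)) J t₀ := by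
  rw [contMDiffWithinAt_totalSpace, contMDiffWithinAt_iff_contDiffWithinAt]
  rfl

theorem SmoothAlongOn.mdiffAlongAt (hV : SmoothAlongOn I γ V J) (hJ : IsOpen J) {t : ℝ}
    (ht : t ∈ J) : MDiffAlongAt I γ V t :=
  ((hV t ht).contMDiffAt (hJ.mem_nhds ht)).mdifferentiableAt (by simp)

theorem SmoothAlongOn.add (hV : SmoothAlongOn I γ V J) (hW : SmoothAlongOn I γ W J) :
    SmoothAlongOn I γ (fun t => V t + W t) J := fun t₀ ht₀ => by
  have hV' := contMDiffWithinAt_along_iff.1 (hV t₀ ht₀)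
  have hW' := contMDiffWithinAt_along_iff.1 (hW t₀ ht₀)
  refine contMDiffWithinAt_along_iff.2 ⟨hV'.1, (hV'.2.add hW'.2).congr_of_eventuallyEq ?_ ?_⟩
  · filter_upwards [hV'.1.continuousWithinAt.eventually
      (eventually_mem_baseSet_self (E := E) (I := I) (γ t₀))]
      with t ht using coords_add ht _ _
  · exact coords_add (mem_baseSet_trivializationAt' _) _ _

theorem SmoothAlongOn.const_smul (c : ℝ) (hV : SmoothAlongOn I γ V J) :
    SmoothAlongOn I γ (fun t => c • V t) J := fun t₀ ht₀ => by
  have hV' := contMDiffWithinAt_along_iff.1 (hV t₀ ht₀)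
  refine contMDiffWithinAt_along_iff.2 ⟨hV'.1, (hV'.2.const_smul c).congr_of_eventuallyEq ?_ ?_⟩
  · filter_upwards [hV'.1.continuousWithinAt.eventually
      (eventually_mem_baseSet_self (E := E) (I := I) (γ t₀))]
      with t ht using coords_smul ht _ _
  · exact coords_smul (mem_baseSet_trivializationAt' _) _ _

theorem smoothAlongOn_velocity (hγ : ContMDiffOn 𝓘(ℝ, ℝ) I ∞ γ J) (hJ : IsOpen J) :
    SmoothAlongOn I γ (velocity I γ) J := by
  have h1 := hγ.contMDiffOn_tangentMapWithin (m := ∞) (by simp) hJ.uniqueMDiffOn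
  have h2 : ContMDiff 𝓘(ℝ, ℝ) 𝓘(ℝ, ℝ).tangent ∞
      (fun t : ℝ => (⟨t, (1 : ℝ)⟩ : TangentBundle 𝓘(ℝ, ℝ) ℝ)) := by
    exact contMDiff_vectorSpace_iff_contDiff.2 contDiff_const
  refine (h1.comp h2.contMDiffOn fun t ht => ht).congr fun t ht => ?_
  simp [tangentMapWithin, velocity, mfderivWithin_of_isOpen hJ ht]

theorem FramedPhiStructure.smoothAlongOn_φ
    {g : ContMDiffRiemannianMetric I ∞ E (fun x : M => TangentSpace I x)} {s : ℕ}
    (C : FramedPhiStructure g s) (hV : SmoothAlongOn I γ V J)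
    (hγ : ContMDiffOn 𝓘(ℝ, ℝ) I ∞ γ J) :
    SmoothAlongOn I γ (fun t => C.φ (γ t) (V t)) J := by
  apply ContMDiffOn.clm_bundle_apply (F₁ := E) (F₂ := E) (b := γ)
    (ϕ := fun t => C.φ (γ t))
  · exact C.φ_smooth.comp_contMDiffOn hγ
  · exact hV

theorem FramedPhiStructure.contMDiff_slantField
    {g : ContMDiffRiemannianMetric I ∞ E (fun x : M => TangentSpace I x)} {s : ℕ}
    (C : FramedPhiStructure g s) (θ : Fin s → ℝ) :
    ContMDiff I I.tangent ∞ (fun x => (⟨x, C.slantField θ x⟩ : TangentBundle I M)) :=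
  ContMDiff.sum_section fun α _ => (C.ξ_smooth α).const_smul_section

variable {g : ContMDiffRiemannianMetric I ∞ E (fun x : M => TangentSpace I x)} {s : ℕ}

theorem IsUnitSpeedCurve.smoothAlongOn_velocity (hγ : IsUnitSpeedCurve g γ J) :
    SmoothAlongOn I γ (velocity I γ) J :=
  MagneticCurves.smoothAlongOn_velocity hγ.contMDiffOn hγ.isOpen

theorem IsUnitSpeedCurve.mdifferentiableAt (hγ : IsUnitSpeedCurve g γ J) {t : ℝ} (ht : t ∈ J) :
    MDifferentiableAt 𝓘(ℝ, ℝ) I γ t :=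
  (hγ.contMDiffOn.contMDiffAt (hγ.isOpen.mem_nhds ht)).mdifferentiableAt (by simp)

theorem isMIntegralCurveOn_iff {X : Π x : M, TangentSpace I x} (hγ : IsUnitSpeedCurve g γ J) :
    IsMIntegralCurveOn γ X J ↔ ∀ t ∈ J, velocity I γ t = X (γ t) := by
  refine forall₂_congr fun t ht => ⟨fun h => ?_, fun h => ?_⟩
  · rw [velocity, (h.hasMFDerivAt (hγ.isOpen.mem_nhds ht)).mfderiv]
    exact one_smul ℝ _
  · have h1 := (hγ.mdifferentiableAt ht).hasMFDerivAt.hasMFDerivWithinAt (s := J)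
    have h2 : mfderiv 𝓘(ℝ, ℝ) I γ t = (1 : ℝ →L[ℝ] ℝ).smulRight (X (γ t)) := by
      rw [← h]
      exact ContinuousLinearMap.ext_ring (one_smul ℝ (velocity I γ t)).symm
    rwa [h2] at h1

namespace FramedPhiStructure

variable {C : FramedPhiStructure g s} {θ : Fin s → ℝ}

theorem IsSlant.inner_φ_φ (hs : C.IsSlant γ J θ) (hγ : IsUnitSpeedCurve g γ J) {t : ℝ}
    (ht : t ∈ J) : g.inner (γ t) (C.φ (γ t) (velocity I γ t)) (C.φ (γ t) (velocity I γ t)) =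
      1 - ∑ α, Real.cos (θ α) ^ 2 := by
  rw [C.g_φ_φ, hγ.unit_speed t ht]
  simp only [hs t ht, sq]

theorem IsSlant.φ_φ (hs : C.IsSlant γ J θ) {t : ℝ} (ht : t ∈ J) :
    C.φ (γ t) (C.φ (γ t) (velocity I γ t)) = -velocity I γ t + C.slantField θ (γ t) := by
  rw [C.φ_sq]
  simp only [hs t ht, slantField]

theorem IsSlant.sum_cos_sq_le_one (hs : C.IsSlant γ J θ) (hγ : IsUnitSpeedCurve g γ J) :
    ∑ α, Real.cos (θ α) ^ 2 ≤ 1 := by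
  obtain ⟨t, ht⟩ := hγ.nonempty
  linarith [hs.inner_φ_φ hγ ht, inner_self_nonneg (g := g) (C.φ (γ t) (velocity I γ t))]

theorem IsSlant.φ_eq_zero (hs : C.IsSlant γ J θ) (hγ : IsUnitSpeedCurve g γ J)
    (hθ : ∑ α, Real.cos (θ α) ^ 2 = 1) {t : ℝ} (ht : t ∈ J) :
    C.φ (γ t) (velocity I γ t) = 0 := by
  by_contra h
  have h1 := g.pos _ _ h
  rw [hs.inner_φ_φ hγ ht, hθ, sub_self] at h1
  exact lt_irrefl _ h1

end FramedPhiStructure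

end SmoothAlong

/-! ### Magnetic curves of a `C`-manifold -/

section MagneticCurve

variable {E : Type*} [NormedAddCommGroup E] [NormedSpace ℝ E] [FiniteDimensional ℝ E]
  {H : Type*} [TopologicalSpace H] {I : ModelWithCorners ℝ E H}
  {M : Type*} [TopologicalSpace M] [ChartedSpace H M] [IsManifold I ∞ M]
  {g : ContMDiffRiemannianMetric I ∞ E (fun x : M => TangentSpace I x)} {s : ℕ}
  {γ : ℝ → M} {J : Set ℝ} {q : ℝ} {θ : Fin s → ℝ}

theorem IsFrenetCurve.covDerivAlong_velocity {r : ℕ} {v : ℕ → Π t : ℝ, TangentSpace I (γ t)}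
    {κ : ℕ → ℝ → ℝ} (hF : IsFrenetCurve g γ J r v κ) (hr : 1 < r) {t : ℝ} (ht : t ∈ J) :
    covDerivAlong g γ (velocity I γ) t = κ 1 t • v 2 t := by
  have h1 : ∀ᶠ t' in 𝓝 t, velocity I γ t' = v 1 t' := by
    filter_upwards [hF.isUnitSpeedCurve.isOpen.mem_nhds ht] with t' ht' using (hF.v_one t' ht').symm
  rw [covDerivAlong_congr g h1, hF.frenet 1 ⟨le_rfl, hF.one_le⟩ t ht]
  simp [hr]

namespace FramedPhiStructure

variable {C : FramedPhiStructure g s}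

/-- The Lorentz force of `q Ω` is `-q φ`. -/
theorem isMagneticCurve_iff (C : FramedPhiStructure g s) :
    IsMagneticCurve g (C.contactMagneticField q) γ J ↔
    ∀ t ∈ J, covDerivAlong g γ (velocity I γ) t = -(q • C.φ (γ t) (velocity I γ t)) := by
  constructor
  · rintro ⟨Φ, hΦ, h⟩ t ht
    rw [h t ht]
    refine ext_inner g fun Z _ => ?_
    rw [hΦ]
    simp [contactMagneticField, fundamentalForm, C.inner_φ_left]
  · intro h
    refine ⟨fun x => -(q • C.φ x), fun x X Y => ?_, fun t ht => by simp [h t ht]⟩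
    simp [contactMagneticField, fundamentalForm, C.inner_φ_left]

theorem IsCManifold.covDerivAlong_φ (hC : C.IsCManifold) {V : Π t : ℝ, TangentSpace I (γ t)}
    {t : ℝ} (hV : MDiffAlongAt I γ V t) :
    covDerivAlong g γ (fun t => C.φ (γ t) (V t)) t = C.φ (γ t) (covDerivAlong g γ V t) := by
  rw [C.covDerivAlong_φ hV, (hC.parallel _).1, add_zero]

theorem IsCManifold.covDerivAlong_slantField (hC : C.IsCManifold) {t : ℝ}
    (hγ : MDifferentiableAt 𝓘(ℝ, ℝ) I γ t) :
    covDerivAlong g γ (fun t => C.slantField θ (γ t)) t = 0 := by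
  have h := (covDerivAlong_sum g Finset.univ (f := fun α _ => Real.cos (θ α)) (X := C.ξ) hγ
    (fun α => differentiableAt_const _) (fun α => C.mdifferentiableAt_ξ α _)).2
  simp only [(hC.parallel _).2] at h
  simp only [deriv_const, smul_zero, zero_smul, add_zero, Finset.sum_const_zero] at h
  exact h

/-- A magnetic curve is slant: `η^α(T)` has derivative `g(-q φ T, ξ_α) = 0`. -/
theorem IsCManifold.exists_isSlant (hC : C.IsCManifold) (hγ : IsUnitSpeedCurve g γ J)
    (h : ∀ t ∈ J, covDerivAlong g γ (velocity I γ) t = -(q • C.φ (γ t) (velocity I γ t))) :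
    ∃ θ : Fin s → ℝ, C.IsSlant γ J θ := by
  obtain ⟨t₀, ht₀⟩ := hγ.nonempty
  have hconst : ∀ α, ∀ t ∈ J, C.η α (γ t) (velocity I γ t) = C.η α (γ t₀) (velocity I γ t₀) := by
    intro α t ht
    have hd : ∀ t ∈ J, HasDerivAt (fun t => C.η α (γ t) (velocity I γ t)) 0 t := by
      intro t ht
      have h1 := hasDerivAt_inner_comp g (hγ.smoothAlongOn_velocity.mdiffAlongAt hγ.isOpen ht)
        (C.mdifferentiableAt_ξ α (γ t))
      rw [h t ht, (hC.parallel _).2] at h1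
      simp only [C.η_eq]
      convert h1 using 1
      simp [← C.η_eq, C.η_φ]
    exact hγ.isOpen.is_const_of_deriv_eq_zero hγ.ordConnected.isPreconnected
      (fun t ht => (hd t ht).differentiableAt.differentiableWithinAt)
      (fun t ht => (hd t ht).deriv) ht ht₀
  have hle : ∀ α, C.η α (γ t₀) (velocity I γ t₀) ^ 2 ≤ 1 := by
    intro α
    have h1 := C.g_φ_φ (γ t₀) (velocity I γ t₀) (velocity I γ t₀)
    rw [hγ.unit_speed t₀ ht₀] at h1
    have h2 := inner_self_nonneg (g := g) (C.φ (γ t₀) (velocity I γ t₀))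
    have h3 := Finset.single_le_sum (f := fun α => C.η α (γ t₀) (velocity I γ t₀) *
      C.η α (γ t₀) (velocity I γ t₀)) (fun β _ => mul_self_nonneg _) (Finset.mem_univ α)
    nlinarith
  refine ⟨fun α => Real.arccos (C.η α (γ t₀) (velocity I γ t₀)), fun t ht α => ?_⟩
  have h1 := abs_le.1 ((sq_le_one_iff_abs_le_one _).1 (hle α))
  rw [hconst α t ht, Real.cos_arccos h1.1 h1.2]

/-- A Legendre magnetic curve satisfies the Frenet equations of a circle, because
`∇_T (φ T) = -q φ² T = q T`. -/
theorem IsCManifold.exists_isCircle (hC : C.IsCManifold) (hγ : IsUnitSpeedCurve g γ J) (hq : q ≠ 0)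
    (h : ∀ t ∈ J, covDerivAlong g γ (velocity I γ) t = -(q • C.φ (γ t) (velocity I γ t)))
    (hL : C.IsLegendre γ J) :
    ∃ (v : ℕ → Π t : ℝ, TangentSpace I (γ t)) (κ : ℕ → ℝ → ℝ), IsCircle g γ J v κ ∧
      ∀ t ∈ J, κ 1 t = |q| ∧ v 2 t = -(Real.sign q • C.φ (γ t) (velocity I γ t)) := by
  have hσ : Real.sign q * q = |q| := sign_mul_self_eq_abs q
  have hσσ : Real.sign q * Real.sign q = 1 := sign_mul_sign hq
  have hqσ : |q| * Real.sign q = q := abs_mul_sign hq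
  let v : ℕ → Π t : ℝ, TangentSpace I (γ t) := fun i t => match i with
    | 1 => velocity I γ t
    | _ => (-Real.sign q) • C.φ (γ t) (velocity I γ t)
  have hT := hγ.smoothAlongOn_velocity
  have hφT := C.smoothAlongOn_φ hT hγ.contMDiffOn
  refine ⟨v, fun _ _ => |q|, ⟨⟨hγ, by norm_num, ?_, ?_, fun _ _ => rfl, ?_, ?_⟩, |q|,
    abs_pos.2 hq, fun _ _ => rfl⟩, fun t ht => ⟨rfl, neg_smul _ _⟩⟩
  · rintro i ⟨h1, h2⟩
    interval_cases i
    · exact hT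
    · exact hφT.const_smul _
  · rintro t ht i ⟨h1, h2⟩ j ⟨h3, h4⟩
    have e1 := hγ.unit_speed t ht
    have e2 := C.inner_self_φ (γ t) (velocity I γ t)
    have e3 := (g.symm (γ t) _ _).trans e2
    have e4 := C.g_φ_φ (γ t) (velocity I γ t) (velocity I γ t)
    simp only [hL t ht, e1, mul_zero, Finset.sum_const_zero, sub_zero] at e4
    interval_cases i <;> interval_cases j <;> simp [v, e1, e2, e3, e4, hσσ]
  · intro i _ t _
    exact abs_pos.2 hq
  · rintro i ⟨h1, h2⟩ t ht
    interval_cases i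
    · change covDerivAlong g γ (velocity I γ) t = _
      simp [h t ht, v, smul_smul, hqσ]
    · change covDerivAlong g γ (fun t => (-Real.sign q) • C.φ (γ t) (velocity I γ t)) t = _
      rw [covDerivAlong_const_smul g _ (hφT.mdiffAlongAt hγ.isOpen ht),
        hC.covDerivAlong_φ (hT.mdiffAlongAt hγ.isOpen ht), h t ht]
      simp [v, C.φ_sq, hL t ht, smul_smul, hσ]

/-- A slant magnetic curve with `0 < K < 1`, `K = ∑ cos² θ_α`, satisfies the Frenet equations of a
helix; `v₃` is the normalization of the part of `∑ cos θ_α ξ_α` orthogonal to `T`. -/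
theorem IsCManifold.exists_isHelix (hC : C.IsCManifold) (hγ : IsUnitSpeedCurve g γ J) (hq : q ≠ 0)
    (h : ∀ t ∈ J, covDerivAlong g γ (velocity I γ) t = -(q • C.φ (γ t) (velocity I γ t)))
    (hs : C.IsSlant γ J θ) {K : ℝ} (hK : ∑ α, Real.cos (θ α) ^ 2 = K) (hK0 : 0 < K) (hK1 : K < 1) :
    ∃ (v : ℕ → Π t : ℝ, TangentSpace I (γ t)) (κ : ℕ → ℝ → ℝ), IsHelix g γ J v κ ∧
      ∀ t ∈ J, κ 1 t = |q| * √(1 - K) ∧ κ 2 t = |q| * √K ∧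
        v 2 t = (-Real.sign q / √(1 - K)) • C.φ (γ t) (velocity I γ t) ∧
        v 3 t = (1 / (√K * √(1 - K))) • (C.slantField θ (γ t) - K • velocity I γ t) := by
  have hσ : Real.sign q * q = |q| := sign_mul_self_eq_abs q
  have hσσ : Real.sign q * Real.sign q = 1 := sign_mul_sign hq
  have hqσ : |q| * Real.sign q = q := abs_mul_sign hq
  obtain ⟨a, ha⟩ : ∃ a, a = √(1 - K) := ⟨_, rfl⟩
  obtain ⟨b, hb⟩ : ∃ b, b = √K := ⟨_, rfl⟩
  have ha0 : 0 < a := ha ▸ Real.sqrt_pos.2 (by linarith)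
  have hb0 : 0 < b := hb ▸ Real.sqrt_pos.2 hK0
  have haa : a * a = 1 - K := ha ▸ Real.mul_self_sqrt (by linarith)
  have hbb : b * b = K := hb ▸ Real.mul_self_sqrt hK0.le
  rw [← ha, ← hb]
  let v : ℕ → Π t : ℝ, TangentSpace I (γ t) := fun i t => match i with
    | 1 => velocity I γ t
    | 2 => (-Real.sign q / a) • C.φ (γ t) (velocity I γ t)
    | _ => (1 / (b * a)) • (C.slantField θ (γ t) - K • velocity I γ t)
  let κ : ℕ → ℝ → ℝ := fun i _ => match i with
    | 1 => |q| * a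
    | _ => |q| * b
  have hκ1 : 0 < |q| * a := mul_pos (abs_pos.2 hq) ha0
  have hκ2 : 0 < |q| * b := mul_pos (abs_pos.2 hq) hb0
  have hT := hγ.smoothAlongOn_velocity
  have hφT := C.smoothAlongOn_φ hT hγ.contMDiffOn
  have hS : SmoothAlongOn I γ (fun t => C.slantField θ (γ t)) J :=
    (C.contMDiff_slantField θ).comp_contMDiffOn hγ.contMDiffOn
  have hv3 : v 3 = fun t => (1 / (b * a)) • (C.slantField θ (γ t) + (-K) • velocity I γ t) := by
    funext t
    simp [v, sub_eq_add_neg]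
  have hST : SmoothAlongOn I γ (fun t => C.slantField θ (γ t) + (-K) • velocity I γ t) J :=
    hS.add (hT.const_smul _)
  refine ⟨v, κ, ⟨⟨hγ, by norm_num, ?_, ?_, fun _ _ => rfl, ?_, ?_⟩, ⟨|q| * a, hκ1, fun _ _ => rfl⟩,
    ⟨|q| * b, hκ2, fun _ _ => rfl⟩⟩, fun t ht => ⟨rfl, rfl, rfl, rfl⟩⟩
  · rintro i ⟨h1, h2⟩
    interval_cases i
    · exact hT
    · exact hφT.const_smul _
    · rw [hv3]
      exact hST.const_smul _
  · rintro t ht i ⟨h1, h2⟩ j ⟨h3, h4⟩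
    have e1 := hγ.unit_speed t ht
    have e2 := C.inner_self_φ (γ t) (velocity I γ t)
    have e3 := (g.symm (γ t) _ _).trans e2
    have e4 := hs.inner_φ_φ hγ ht
    have e5 : g.inner (γ t) (velocity I γ t) (C.slantField θ (γ t)) = K := by
      simp [C.inner_slantField, hs t ht, ← hK, sq]
    have e6 := (g.symm (γ t) _ _).trans e5
    have e7 : g.inner (γ t) (C.slantField θ (γ t)) (C.slantField θ (γ t)) = K := by
      simp [C.inner_slantField, C.η_slantField, ← hK, sq]
    have e8 : g.inner (γ t) (C.φ (γ t) (velocity I γ t)) (C.slantField θ (γ t)) = 0 := by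
      simp [C.inner_slantField, C.η_φ]
    have e9 := (g.symm (γ t) _ _).trans e8
    rw [hK, ← haa] at e4
    interval_cases i <;> interval_cases j <;> simp [v, e1, e2, e3, e4, e5, e6, e7, e8, e9]
    · have e : -Real.sign q / a * (-Real.sign q / a * (a * a)) = Real.sign q * Real.sign q := by
        field_simp
      rw [e, hσσ]
    · have e : K - K * K = a * a * (b * b) := by rw [haa, hbb]; ring
      rw [e]
      field_simp
  · rintro i ⟨h1, h2⟩ t ht
    interval_cases i
    · exact hκ1
    · exact hκ2
  · rintro i ⟨h1, h2⟩ t ht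
    have hTt := hT.mdiffAlongAt hγ.isOpen ht
    interval_cases i
    · change covDerivAlong g γ (velocity I γ) t = _
      have e : |q| * a * (-Real.sign q / a) = -q := by field_simp; linarith
      simp [h t ht, v, κ, smul_smul, e]
    · change covDerivAlong g γ (fun t => (-Real.sign q / a) • C.φ (γ t) (velocity I γ t)) t = _
      rw [covDerivAlong_const_smul g _ (hφT.mdiffAlongAt hγ.isOpen ht),
        hC.covDerivAlong_φ hTt, h t ht, map_neg, map_smul, hs.φ_φ ht]
      simp [v, κ]
      have c1 : -Real.sign q / a * q = -(|q| / a) := by rw [← hσ]; ring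
      have c2 : |q| * b * (a⁻¹ * b⁻¹) = |q| / a := by field_simp
      have c3 : |q| * a = |q| / a - |q| / a * K := by
        rw [← hbb, show b * b = 1 - a * a by rw [haa, hbb]; ring]
        field_simp
        ring
      rw [smul_smul, smul_smul, smul_smul, c1, c2, c3]
      module
    · rw [hv3, covDerivAlong_const_smul g _ (hST.mdiffAlongAt hγ.isOpen ht),
        covDerivAlong_add g (hS.mdiffAlongAt hγ.isOpen ht)
        ((hT.const_smul _).mdiffAlongAt hγ.isOpen ht),
        covDerivAlong_const_smul g _ hTt, hC.covDerivAlong_slantField (hγ.mdifferentiableAt ht),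
        h t ht]
      simp [v, κ, smul_smul]
      have c : a⁻¹ * b⁻¹ * (K * q) = -(|q| * b * (-Real.sign q / a)) := by
        rw [← hbb]
        field_simp
        linarith
      rw [c, neg_smul]

end FramedPhiStructure
end MagneticCurve

end MagneticCurves

theorem theorem1 {n s : ℕ}
    {E : Type*} [NormedAddCommGroup E] [NormedSpace ℝ E] [FiniteDimensional ℝ E]
    (hdim : Module.finrank ℝ E = 2 * n + s)
    {M : Type*} [TopologicalSpace M] [ChartedSpace E M] [IsManifold 𝓘(ℝ, E) ∞ M]
    (g : ContMDiffRiemannianMetric 𝓘(ℝ, E) ∞ E (fun x : M => TangentSpace 𝓘(ℝ, E) x))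
    (C : FramedPhiStructure g s) (hC : C.IsCManifold)
    (q : ℝ) (hq : q ≠ 0) (γ : ℝ → M) (J : Set ℝ) (hγ : IsUnitSpeedCurve g γ J) :
    IsNormalMagneticCurve g (C.contactMagneticField q) γ J ↔
      (∃ θ : Fin s → ℝ, IsGeodesic g γ J ∧ C.IsSlant γ J θ ∧
        ∑ α, Real.cos (θ α) ^ 2 = 1 ∧
        (IsMIntegralCurveOn γ (C.slantField θ) J ∨
          IsMIntegralCurveOn γ (-C.slantField θ) J)) ∨
      (∃ (v : ℕ → Π t : ℝ, TangentSpace 𝓘(ℝ, E) (γ t)) (κ : ℕ → ℝ → ℝ),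
        C.IsLegendre γ J ∧ IsCircle g γ J v κ ∧
        ∀ t ∈ J, κ 1 t = |q| ∧
          v 2 t = -(Real.sign q • C.φ (γ t) (velocity 𝓘(ℝ, E) γ t))) ∨
      (∃ (θ : Fin s → ℝ) (v : ℕ → Π t : ℝ, TangentSpace 𝓘(ℝ, E) (γ t)) (κ : ℕ → ℝ → ℝ),
        ¬ C.IsLegendre γ J ∧ C.IsSlant γ J θ ∧ IsHelix g γ J v κ ∧
        ∑ α, Real.cos (θ α) ^ 2 < 1 ∧
        ∀ t ∈ J,
          κ 1 t = |q| * √(1 - ∑ α, Real.cos (θ α) ^ 2) ∧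
          κ 2 t = |q| * √(∑ α, Real.cos (θ α) ^ 2) ∧
          v 2 t = (-Real.sign q / √(1 - ∑ α, Real.cos (θ α) ^ 2)) •
            C.φ (γ t) (velocity 𝓘(ℝ, E) γ t) ∧
          v 3 t = (1 / (√(∑ α, Real.cos (θ α) ^ 2) * √(1 - ∑ α, Real.cos (θ α) ^ 2))) •
            (C.slantField θ (γ t) -
              (∑ α, Real.cos (θ α) ^ 2) • velocity 𝓘(ℝ, E) γ t)) := by
  have hmag : IsNormalMagneticCurve g (C.contactMagneticField q) γ J ↔
      ∀ t ∈ J, covDerivAlong g γ (velocity 𝓘(ℝ, E) γ) t =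
        -(q • C.φ (γ t) (velocity 𝓘(ℝ, E) γ t)) :=
    (and_iff_right hγ).trans C.isMagneticCurve_iff
  have hqσ : |q| * Real.sign q = q := abs_mul_sign hq
  rw [hmag]
  constructor
  · intro h
    obtain ⟨θ, hs⟩ := hC.exists_isSlant hγ h
    obtain ⟨t₀, ht₀⟩ := hγ.nonempty
    have hK0 : 0 ≤ ∑ α, Real.cos (θ α) ^ 2 := Finset.sum_nonneg fun α _ => sq_nonneg _
    have hK1 : ∑ α, Real.cos (θ α) ^ 2 ≤ 1 := hs.sum_cos_sq_le_one hγ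
    have hL : C.IsLegendre γ J ↔ ∑ α, Real.cos (θ α) ^ 2 = 0 := by
      rw [Finset.sum_eq_zero_iff_of_nonneg fun α _ => sq_nonneg _]
      refine ⟨fun hL α _ => ?_, fun h0 t ht α => ?_⟩
      · rw [← hs t₀ ht₀, hL t₀ ht₀, sq, zero_mul]
      · rw [hs t ht]
        exact pow_eq_zero_iff two_ne_zero |>.1 (h0 α (Finset.mem_univ α))
    -- The cases `K = 1`, `K = 0` and `0 < K < 1`, for `K = ∑ cos² θ_α = 1 - |φ T|²`.
    rcases hK1.eq_or_lt with hK1 | hK1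
    · left
      have hφ : ∀ t ∈ J, C.φ (γ t) (velocity 𝓘(ℝ, E) γ t) = 0 := fun t ht =>
        hs.φ_eq_zero hγ hK1 ht
      refine ⟨θ, fun t ht => by rw [h t ht, hφ t ht, smul_zero, neg_zero], hs, hK1,
        Or.inl ((isMIntegralCurveOn_iff hγ).2 fun t ht => ?_)⟩
      have h1 := hs.φ_φ ht
      rw [hφ t ht, map_zero] at h1
      exact (neg_add_eq_zero.1 h1.symm)
    rcases hK0.eq_or_lt with hK0 | hK0
    · right; left
      have hL := hL.2 hK0.symm
      obtain ⟨v, κ, h1, h2⟩ := hC.exists_isCircle hγ hq h hL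
      exact ⟨v, κ, hL, h1, h2⟩
    · right; right
      obtain ⟨v, κ, h1, h2⟩ := hC.exists_isHelix hγ hq h hs rfl hK0 hK1
      exact ⟨θ, v, κ, fun h0 => hK0.ne' (hL.1 h0), hs, h1, hK1, h2⟩
  -- Only the equation for `∇_T T` is needed in the converse, not the parallelism of `φ` and `ξ_α`.
  · rintro (⟨θ, hgeo, -, -, hint⟩ | ⟨v, κ, -, ⟨hF, -⟩, hv⟩ | ⟨θ, v, κ, -, -, ⟨hF, -⟩, hK, hv⟩) t ht
    · rw [hgeo t ht]
      have h1 : C.φ (γ t) (velocity 𝓘(ℝ, E) γ t) = 0 := by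
        rcases hint with hint | hint <;> rw [(isMIntegralCurveOn_iff hγ).1 hint t ht] <;>
          simp [C.φ_slantField]
      rw [h1, smul_zero, neg_zero]
    · rw [hF.covDerivAlong_velocity (by norm_num) ht, (hv t ht).1, (hv t ht).2, smul_neg,
        smul_smul, hqσ]
    · have ha : 0 < √(1 - ∑ α, Real.cos (θ α) ^ 2) := Real.sqrt_pos.2 (by linarith)
      obtain ⟨h1, -, h2, -⟩ := hv t ht
      rw [hF.covDerivAlong_velocity (by norm_num) ht, h1, h2, smul_smul, ← neg_smul]
      congr 1
      field_simp
      linarith
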